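/- Let $\mathcal P$ be a homogeneous Poisson process of intensity $1$ on $\mathbb R$ with point set $[\mathcal P]$, and let $\mu$ be a probability measure on the strictly positive integers. Conditionally on $\mathcal P$, let the points $x\in[\mathcal P]$ carry i.i.d. degrees $D_x$ with law $\mu$, encoded by the integer-valued random measure $\xi$ with $\xi(\{x\})=D_x$; conditionally on $\mathcal P$ and $\xi$, let $R_x\sim\mathrm{Binomial}(D_x,1/2)$ be independent for $x\in[\mathcal P]$. Let $\mathcal M$ be a random direction stable multi-matching: a point process of edges (unordered pairs of points of $[\mathcal P]$), invariant in law under all translations of $\mathbb R$, such that almost surely the graph $G$ with vertex set $[\mathcal P]$ and edge set $[\mathcal M]$ has no self-loops and no multiple edges, each $x\in[\mathcal P]$ has degree $D_x$ and is linked to exactly $R_x$ vertices to its right, and for any two points $x<y$ of $[\mathcal P]$ either $x$ and $y$ are linked by an edge, or no edge linking $x$ to a vertex on its right is longer than $|x-y|$, or no edge linking $y$ to a vertex on its left is longer than $|x-y|$. Let $X_x$ be the average length of the edges incident to $x\in[\mathcal P]$. Let $\mathbb E^*$ denote expectation for the Palm version of $(\mathcal P,\xi,\mathcal M)$ with respect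 to $\mathcal P$, whose law is $$A\mapsto \mathbb E\,\#\{x\in[\mathcal P]\cap[0,1):\ (\mathcal P,\xi,\mathcal M)\text{ translated by }-x\text{ lies in }A\},$$ and let $X=X_0$ be the average length of the edges incident to the origin in the Palm version. (i) If $\mu(\{2\})=1$, then almost surely $G$ has no connected component with infinitely many vertices. (ii) If $\mu$ has bounded support, then $\mathbb E^*[X^{1/2}]=\infty$. -/

import Mathlib

open MeasureTheory ProbabilityTheory
open scoped ENNReal

namespace StablePoisson

variable {Ω : Type*} [MeasurableSpace Ω]

/-- The set `[ν]` of points (atoms) of `ν`. For an integer-valued, locally finite measure on `ℝ` or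
`ℝ × ℝ` this is its support. -/
def points {E : Type*} [MeasurableSpace E] (ν : Measure E) : Set E :=
  {x | 0 < ν {x}}

/-- A point process on a metric space: a random measure which almost surely takes a finite,
integer value on every bounded measurable set. -/
structure IsPointProcess {E : Type*} [PseudoMetricSpace E] [MeasurableSpace E]
    (P : Measure Ω) (N : Ω → Measure E) : Prop where
  measurable : Measurable N
  integer_valued : ∀ᵐ ω ∂P, ∀ B : Set E, MeasurableSet B → Bornology.IsBounded B →
    ∃ n : ℕ, N ω B = n

/-- A homogeneous Poisson process on `ℝ` with intensity `1`. -/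
structure IsPoissonProcess (P : Measure Ω) (N : Ω → Measure ℝ) : Prop
    extends IsPointProcess P N where
  law : ∀ B : Set ℝ, MeasurableSet B → volume B ≠ ∞ →
    P.map (fun ω => N ω B) =
      (poissonMeasure (volume B).toNNReal).map (fun n : ℕ => (n : ℝ≥0∞))
  indep : ∀ (n : ℕ) (B : Fin n → Set ℝ), (∀ i, MeasurableSet (B i)) →
    Pairwise (fun i j => Disjoint (B i) (B j)) → iIndepFun (fun i ω => N ω (B i)) P

/-- The process `ξ` of degrees: a random integer-valued measure with the same points as `N` such
that, conditionally on `N`, the degrees `D_x = ξ {x}` of the points `x` of `N` are i.i.d. with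
law `μ`. The conditional law is expressed through arbitrary finite tuples `y` of points of `N`
which are chosen measurably from `N`, and which are distinct on the event that `N ∈ A`. -/
structure IsDegreeProcess (P : Measure Ω) (N ξ : Ω → Measure ℝ) (μ : Measure ℕ) : Prop
    extends IsPointProcess P ξ where
  points_eq : ∀ᵐ ω ∂P, points (ξ ω) = points (N ω)
  cond_law : ∀ (n : ℕ) (y : Fin n → Measure ℝ → ℝ) (A : Set (Measure ℝ)) (d : Fin n → ℕ),
    (∀ i, Measurable (y i)) → MeasurableSet A →
    (∀ᵐ ω ∂P, N ω ∈ A →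
      Function.Injective (fun i => y i (N ω)) ∧ ∀ i, y i (N ω) ∈ points (N ω)) →
    P {ω | N ω ∈ A ∧ ∀ i, ξ ω {y i (N ω)} = d i} = P {ω | N ω ∈ A} * ∏ i, μ {d i}

/-- The process `ψ` of directions: a random integer-valued measure whose points are points of `N`
such that, conditionally on `(N, ξ)`, the numbers `R_x = ψ {x}` of right-stubs at the points `x`
of `N` are independent, with `R_x` having law Binomial `(D_x, 1/2)`, where `D_x = ξ {x}`. -/
structure IsDirectionProcess (P : Measure Ω) (N ξ ψ : Ω → Measure ℝ) : Prop
    extends IsPointProcess P ψ where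
  points_subset : ∀ᵐ ω ∂P, points (ψ ω) ⊆ points (N ω)
  cond_law : ∀ (n : ℕ) (y : Fin n → Measure ℝ × Measure ℝ → ℝ) (A : Set (Measure ℝ × Measure ℝ))
    (d r : Fin n → ℕ), (∀ i, Measurable (y i)) → MeasurableSet A →
    (∀ᵐ ω ∂P, (N ω, ξ ω) ∈ A →
      Function.Injective (fun i => y i (N ω, ξ ω)) ∧ ∀ i, y i (N ω, ξ ω) ∈ points (N ω)) →
    P {ω | (N ω, ξ ω) ∈ A ∧
        ∀ i, ξ ω {y i (N ω, ξ ω)} = d i ∧ ψ ω {y i (N ω, ξ ω)} = r i} =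
      P {ω | (N ω, ξ ω) ∈ A ∧ ∀ i, ξ ω {y i (N ω, ξ ω)} = d i} *
        ∏ i, binomial (d i) ⟨1 / 2, by norm_num, by norm_num⟩ {r i}

/-- A simple, translation-invariant matching scheme for `(N, ξ)`. An edge, that is an unordered
pair of two distinct points of `ℝ`, is represented by the pair `(x, y)` of its end-points in
increasing order `x < y`. -/
structure IsMatchingScheme (P : Measure Ω) (N ξ : Ω → Measure ℝ) (M : Ω → Measure (ℝ × ℝ)) : Prop
    extends IsPointProcess P M where
  /-- Edges are listed in increasing order; in particular there are no self-loops. -/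
  ordered : ∀ᵐ ω ∂P, ∀ p ∈ points (M ω), p.1 < p.2
  /-- There are no multiple edges. -/
  simple : ∀ᵐ ω ∂P, ∀ p, M ω {p} ≤ 1
  endpoints : ∀ᵐ ω ∂P, ∀ p ∈ points (M ω), p.1 ∈ points (N ω) ∧ p.2 ∈ points (N ω)
  /-- Each vertex `x` has degree `D_x`. -/
  degree : ∀ᵐ ω ∂P, ∀ x ∈ points (N ω), M ω {p | p.1 = x ∨ p.2 = x} = ξ ω {x}
  translation_invariant : ∀ t : ℝ,
    P.map (fun ω => (M ω).map (fun p => (p.1 + t, p.2 + t))) = P.map M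

/-- A random direction stable multi-matching: each vertex `x` has exactly `R_x = ψ {x}` incident
right-edges, and for any two vertices `x < y`, either they are linked by an edge, or `x` has no
right-edge longer than `|x - y|`, or `y` has no left-edge longer than `|x - y|`. -/
structure IsRandomDirectionStable (P : Measure Ω) (N ξ ψ : Ω → Measure ℝ)
    (M : Ω → Measure (ℝ × ℝ)) : Prop extends IsMatchingScheme P N ξ M where
  right_degree : ∀ᵐ ω ∂P, ∀ x ∈ points (N ω), M ω {p | p.1 = x} = ψ ω {x}
  stable : ∀ᵐ ω ∂P, ∀ x ∈ points (N ω), ∀ y ∈ points (N ω), x < y →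
    (x, y) ∈ points (M ω) ∨
    (∀ z, (x, z) ∈ points (M ω) → |x - z| ≤ |x - y|) ∨
    (∀ z, (z, y) ∈ points (M ω) → |z - y| ≤ |x - y|)

/-- The graph with vertex set `[π]` and edge set `[m]`. -/
def graph (π : Measure ℝ) (m : Measure (ℝ × ℝ)) : SimpleGraph (points π) :=
  SimpleGraph.fromRel fun x y => ((x : ℝ), (y : ℝ)) ∈ points m

/-- The graph has a component with infinitely many vertices. -/
def HasInfiniteComponent (π : Measure ℝ) (m : Measure (ℝ × ℝ)) : Prop :=
  ∃ C : (graph π m).ConnectedComponent, C.supp.Infinite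

/-- The average length `X_x` of all edges incident to `x`, when there are `ξ {x}` of them. -/
noncomputable def avgLength (ξ : Measure ℝ) (m : Measure (ℝ × ℝ)) (x : ℝ) : ℝ≥0∞ :=
  (∫⁻ p in {p : ℝ × ℝ | p.1 = x ∨ p.2 = x}, ENNReal.ofReal |p.1 - p.2| ∂m) / ξ {x}

/-- Configurations `(π, ξ, m)` of vertices, degrees and edges. -/
abbrev Config := Measure ℝ × Measure ℝ × Measure (ℝ × ℝ)

/-- The configuration as seen from `s`: the translation which moves `s` to the origin. -/
noncomputable def shift (s : ℝ) (c : Config) : Config :=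
  (c.1.map (fun x => x - s), c.2.1.map (fun x => x - s),
    c.2.2.map (fun p => (p.1 - s, p.2 - s)))

/-- The law of the Palm version of a stationary random configuration `(N, ξ, M)` with respect
to `N`, i.e. `A ↦ E[#{s ∈ [N] ∩ [0,1) : (N, ξ, M) seen from s lies in A}] / E[N[0,1)]`
(points being counted with multiplicity). -/
noncomputable def palmLaw (P : Measure Ω) (N ξ : Ω → Measure ℝ) (M : Ω → Measure (ℝ × ℝ)) :
    Measure Config :=
  (∫⁻ ω, N ω (Set.Ico 0 1) ∂P)⁻¹ •
    P.bind fun ω => ((N ω).restrict (Set.Ico 0 1)).map fun s => shift s (N ω, ξ ω, M ω)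

end StablePoisson

/-!
A vertex `x` of degree `D_x` has `R_x` right-stubs and `D_x - R_x` left-stubs. Stability makes the
edges behave like matched parentheses, up to the effect of the ban on multiple edges. Both parts
rest on one observation: in an interval `[0, T)`, the number of right-stubs minus the number of
left-stubs equals the number of edges leaving the interval to the right minus the number of edges
entering it from the left (`IsStableConfig.isBalanced`). Given the points and the degrees, this
difference is a centred sum of at least `n` independent signs, where `n` is the number of points,
so that it takes each value with probability at most `1 / √n`
(`IsDirectionProcess.prob_stubs_eq_le`); hence it is of order `√T`
(`IsDirectionProcess.prob_isBalanced_le`).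

If only finitely many edges crossed over the origin with positive probability, then, by
stationarity, the difference would be tight on this event as `T → ∞`. Hence infinitely many edges
cross over the origin (`IsRandomDirectionStable.ae_crossingEdges_eq_top`). This excludes infinite
components when all degrees are two: starting from an edge of such a component, a parity argument
(`exists_right_continuation`) shows that the component runs off to the right in such a way that no
edge can enclose the starting edge (`exists_not_enclosed`), which leaves only finitely many edges
over the origin (`IsStableConfig.crossingEdges_ne_top`).

If the average edge length `X` at a typical point satisfied `E*[X^{1/2}] < ∞`, for bounded degrees,
then the expected number of edges of length at least `i` with an end in `[0, 1)` would be
`o(i^{-1/2})` (`tendsto_longEdges`). Summation over `i < T` shows that `o(√T)` edges leave or enter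
`[0, T)` in expectation (`sum_longEdges_le`), against the lower bound of order `√T`
(`IsRandomDirectionStable.le_bind_outEdges_add_inEdges`).
-/

namespace StablePoisson

open Filter
open scoped NNReal Topology

/-! ### Infinite components of stable graphs of degree two -/

section Graph

variable {V : Type*} {G : SimpleGraph V}

/-- Handshake: in a graph whose vertices all have two neighbours, it cannot happen that exactly one
edge leaves a finite set `S` of vertices. -/
lemma not_existsUnique_edge_leaving (hdeg : ∀ x, ∃ u w, u ≠ w ∧ ∀ z, G.Adj x z ↔ z = u ∨ z = w)
    (S : Set V) (hS : S.Finite) (v : V) (hv : v ∈ S)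
    (hcl : ∀ x ∈ S, x ≠ v → ∀ z, G.Adj x z → z ∈ S)
    {u w : V} (huS : u ∈ S) (hwS : w ∉ S) (hu : G.Adj v u) (hw : G.Adj v w) : False := by
  classical
  have := hS.fintype
  set H := G.induce S
  have key : ∀ x : S, (H.neighborSet x).ncard = (G.neighborSet x ∩ S).ncard := by
    intro x
    rw [← Set.ncard_image_of_injective (H.neighborSet x) Subtype.val_injective]
    congr 1
    ext z
    simp [H, and_comm]
  have hcard : ∀ x : S, H.degree x = (G.neighborSet x ∩ S).ncard := by
    intro x
    rw [← key, ← SimpleGraph.card_neighborSet_eq_degree, Set.ncard_eq_toFinset_card',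
      Set.toFinset_card]
  have hodd : Odd (H.degree ⟨v, hv⟩) := by
    rw [hcard]
    have : G.neighborSet v ∩ S = {u} := by
      obtain ⟨a, b, hab, h⟩ := hdeg v
      ext z
      simp only [Set.mem_inter_iff, SimpleGraph.mem_neighborSet, Set.mem_singleton_iff]
      constructor
      · rintro ⟨hz, hzS⟩
        rw [h] at hz hu hw
        grind
      · rintro rfl
        exact ⟨hu, huS⟩
    simp [this]
  obtain ⟨x, hxv, hx⟩ := H.exists_ne_odd_degree_of_exists_odd_degree _ hodd
  rw [hcard] at hx
  obtain ⟨a, b, hab, h⟩ := hdeg x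
  have : G.neighborSet x ∩ S = {a, b} := by
    ext z
    simp only [Set.mem_inter_iff, SimpleGraph.mem_neighborSet, Set.mem_insert_iff,
      Set.mem_singleton_iff, ← h]
    refine ⟨fun hz => hz.1, fun hz => ⟨hz, hcl x x.2 (fun hh => hxv (Subtype.ext hh)) z hz⟩⟩
  rw [this, Set.ncard_pair hab] at hx
  exact absurd hx (by decide)

lemma finite_supp_of_closed {S : Set V} (hS : S.Finite) (hcl : ∀ x ∈ S, ∀ z, G.Adj x z → z ∈ S)
    {x : V} (hx : x ∈ S) : (G.connectedComponentMk x).supp.Finite := by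
  refine hS.subset fun z hz => ?_
  have hr : G.Reachable x z := (SimpleGraph.ConnectedComponent.exact hz).symm
  rw [SimpleGraph.reachable_iff_reflTransGen] at hr
  clear hz
  induction hr with
  | refl => exact hx
  | tail _ h ih => exact hcl _ ih _ h

variable [LinearOrder V]

/-- If `b` has two left-neighbours `a < p` in an infinite component, then the edge joining `p` to
`b` is continued beyond `b`. -/
lemma exists_right_continuation (hfin : ∀ a b : V, (Set.Icc a b).Finite)
    (hdeg : ∀ x, ∃ u w, u ≠ w ∧ ∀ z, G.Adj x z ↔ z = u ∨ z = w)
    (hst : ∀ x y, x < y → G.Adj x y ∨ (∀ z, x < z → G.Adj x z → z ≤ y) ∨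
      (∀ z, z < y → G.Adj z y → x ≤ z))
    {a p b : V} (hap : a < p) (hpb : p < b) (hab : G.Adj a b) (hpb' : G.Adj p b)
    (hinf : (G.connectedComponentMk b).supp.Infinite) : ∃ q, b < q ∧ G.Adj p q := by
  by_contra! hno
  -- the neighbours of `b` are exactly `a` and `p`
  have hbn : ∀ z, G.Adj b z → z = a ∨ z = p := by
    obtain ⟨u, w, huw, h⟩ := hdeg b
    intro z hz
    have h1 := (h a).1 hab.symm
    have h2 := (h p).1 hpb'.symm
    have h3 := (h z).1 hz
    grind
  -- no edge crosses over the end `b`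
  have hb : ∀ x, a < x → x < b → ∀ z, b < z → ¬ G.Adj x z := by
    intro x hax hxb z hbz hxz
    rcases hst x b hxb with h | h | h
    · rcases hbn x h.symm with rfl | rfl
      · exact lt_irrefl _ hax
      · exact hno z hbz hxz
    · exact absurd (h z (hxb.trans hbz) hxz) (not_le.2 hbz)
    · exact absurd (h a (hap.trans hpb) hab) (not_le.2 hax)
  obtain ⟨u, hua, hu⟩ : ∃ u, u ≠ b ∧ ∀ z, G.Adj a z ↔ z = u ∨ z = b := by
    obtain ⟨u, w, huw, h⟩ := hdeg a
    rcases (h b).1 hab with rfl | rfl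
    · exact ⟨w, huw.symm, fun z => by rw [h, or_comm]⟩
    · exact ⟨u, huw, h⟩
  by_cases hcross : ∃ x z, a < x ∧ x < b ∧ z < a ∧ G.Adj x z
  · -- an edge crosses over the end `a`, hence its inner end is the second neighbour of `a`
    obtain ⟨x, z, hax, hxb, hza, hxz⟩ := hcross
    have hcr : ∀ x z, a < x → x < b → z < a → G.Adj x z → x = u ∧ G.Adj x a := by
      intro x z hax hxb hza hxz
      rcases hst a x hax with h | h | h
      · rcases (hu x).1 h with rfl | rfl
        · exact ⟨rfl, h.symm⟩
        · exact absurd hxb (lt_irrefl _)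
      · exact absurd (h b (hap.trans hpb) hab) (not_le.2 hxb)
      · exact absurd (h z (hza.trans hax) hxz.symm) (not_le.2 hza)
    obtain ⟨rfl, hxa⟩ := hcr x z hax hxb hza hxz
    refine not_existsUnique_edge_leaving hdeg (Set.Icc a b) (hfin a b) x ⟨hax.le, hxb.le⟩ ?_
      (u := a) (w := z) ⟨le_rfl, (hap.trans hpb).le⟩ (fun h => absurd h.1 (not_le.2 hza)) hxa hxz
    rintro y ⟨hay, hyb⟩ hyx t hyt
    rcases hay.eq_or_lt with rfl | hay
    · rcases (hu t).1 hyt with rfl | rfl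
      · exact ⟨hax.le, hxb.le⟩
      · exact ⟨hyb, le_rfl⟩
    rcases hyb.eq_or_lt with rfl | hyb
    · rcases hbn t hyt with rfl | rfl
      · exact ⟨le_rfl, hay.le⟩
      · exact ⟨hap.le, hpb.le⟩
    refine ⟨?_, ?_⟩
    · by_contra! hta
      exact hyx (hcr y t hay hyb hta hyt).1
    · by_contra! hbt
      exact hb y hay hyb t hbt hyt
  · push Not at hcross
    have hin : ∀ y, a < y → y ≤ b → ∀ t, G.Adj y t → t ∈ Set.Icc a b := by
      intro y hay hyb t hyt
      rcases hyb.eq_or_lt with rfl | hyb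
      · rcases hbn t hyt with rfl | rfl
        · exact ⟨le_rfl, hay.le⟩
        · exact ⟨hap.le, hpb.le⟩
      refine ⟨?_, ?_⟩
      · by_contra! hta
        exact hcross y t hay hyb hta hyt
      · by_contra! hbt
        exact hb y hay hyb t hbt hyt
    have habI : a ∈ Set.Icc a b := ⟨le_rfl, (hap.trans hpb).le⟩
    have hbI : b ∈ Set.Icc a b := ⟨(hap.trans hpb).le, le_rfl⟩
    by_cases huS : u ∈ Set.Icc a b
    · refine hinf (finite_supp_of_closed (hfin a b) ?_ hbI)
      rintro y ⟨hay, hyb⟩ t hyt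
      rcases hay.eq_or_lt with rfl | hay
      · rcases (hu t).1 hyt with rfl | rfl
        · exact huS
        · exact hbI
      · exact hin y hay hyb t hyt
    · refine not_existsUnique_edge_leaving hdeg (Set.Icc a b) (hfin a b) a habI ?_
        (u := b) (w := u) hbI huS hab ((hu u).2 (Or.inl rfl))
      rintro y ⟨hay, hyb⟩ hya t hyt
      exact hin y (lt_of_le_of_ne hay (Ne.symm hya)) hyb t hyt

/-- In an infinite component, an edge from `x` to its outermost right-neighbour `y` is followed by
an edge `x' y'` of the same kind, which crosses over `y`. -/
lemma exists_next_edge (hfin : ∀ a b : V, (Set.Icc a b).Finite)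
    (hdeg : ∀ x, ∃ u w, u ≠ w ∧ ∀ z, G.Adj x z ↔ z = u ∨ z = w)
    (hst : ∀ x y, x < y → G.Adj x y ∨ (∀ z, x < z → G.Adj x z → z ≤ y) ∨
      (∀ z, z < y → G.Adj z y → x ≤ z))
    {x y : V} (hxy : x < y) (hadj : G.Adj x y) (hout : ∀ z, G.Adj x z → z ≤ y)
    (hinf : (G.connectedComponentMk x).supp.Infinite) :
    ∃ x' y', x < x' ∧ x' ≤ y ∧ y < y' ∧ G.Adj x' y' ∧ (∀ z, G.Adj x' z → z ≤ y') ∧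
      (∃ z ≤ y, G.Adj x' z) ∧ (G.connectedComponentMk x').supp.Infinite := by
  have hinfy : (G.connectedComponentMk y).supp.Infinite := by
    rwa [← SimpleGraph.ConnectedComponent.sound hadj.reachable]
  obtain ⟨w, hwx, hw⟩ : ∃ w, w ≠ x ∧ ∀ z, G.Adj y z ↔ z = x ∨ z = w := by
    obtain ⟨u, w, huw, h⟩ := hdeg y
    rcases (h x).1 hadj.symm with rfl | rfl
    · exact ⟨w, huw.symm, h⟩
    · exact ⟨u, huw, fun z => by rw [h, or_comm]⟩
  have hyw : G.Adj y w := (hw w).2 (Or.inr rfl)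
  rcases lt_trichotomy y w with hlt | heq | hgt
  · refine ⟨y, w, hxy, le_rfl, hlt, hyw, fun z hz => ?_, ⟨x, hxy.le, hadj.symm⟩, hinfy⟩
    rcases (hw z).1 hz with rfl | rfl
    · exact (hxy.trans hlt).le
    · exact le_rfl
  · exact absurd heq hyw.ne
  · rcases lt_or_gt_of_ne hwx with hwx | hwx
    · obtain ⟨q, hq, hxq⟩ := exists_right_continuation hfin hdeg hst hwx hxy hyw.symm hadj hinfy
      exact absurd (hout q hxq) (not_le.2 hq)
    · obtain ⟨q, hq, hwq⟩ := exists_right_continuation hfin hdeg hst hwx hgt hadj hyw.symm hinfy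
      refine ⟨w, q, hwx, hgt.le, hq, hwq, fun z hz => ?_, ⟨y, le_rfl, hyw.symm⟩, ?_⟩
      · obtain ⟨u, t, hut, h⟩ := hdeg w
        have h1 := (h y).1 hyw.symm
        have h2 := (h q).1 hwq
        have h3 := (h z).1 hz
        have : z = y ∨ z = q := by grind
        rcases this with rfl | rfl
        · exact hq.le
        · exact le_rfl
      · rwa [← SimpleGraph.ConnectedComponent.sound hyw.reachable]

/-- An edge of an infinite component which leads to an outermost right-neighbour is not enclosed by
any edge: the edges which follow it would have to pass over the right end of the latter. -/
lemma not_enclosed (hfin : ∀ a b : V, (Set.Icc a b).Finite)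
    (hdeg : ∀ x, ∃ u w, u ≠ w ∧ ∀ z, G.Adj x z ↔ z = u ∨ z = w)
    (hst : ∀ x y, x < y → G.Adj x y ∨ (∀ z, x < z → G.Adj x z → z ≤ y) ∨
      (∀ z, z < y → G.Adj z y → x ≤ z))
    {x y u v : V} (hxy : x < y) (hadj : G.Adj x y) (hout : ∀ z, G.Adj x z → z ≤ y)
    (hinf : (G.connectedComponentMk x).supp.Infinite) (hux : u < x) (hyv : y < v) :
    ¬ G.Adj u v := by
  intro huv
  set T : Set V := {y | ∃ x, u < x ∧ x < y ∧ y < v ∧ G.Adj x y ∧ (∀ z, G.Adj x z → z ≤ y) ∧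
    (G.connectedComponentMk x).supp.Infinite} with hT
  have hTfin : T.Finite := (hfin u v).subset fun y ⟨x, h1, h2, h3, _⟩ => ⟨(h1.trans h2).le, h3.le⟩
  obtain ⟨y, ⟨x, hux, hxy, hyv, hadj, hout, hinf⟩, hmax⟩ :=
    hTfin.exists_maximal ⟨y, x, hux, hxy, hyv, hadj, hout, hinf⟩
  obtain ⟨x', y', hx', hxy', hyy', hadj', hout', ⟨z, hzy, hz⟩, hinf'⟩ :=
    exists_next_edge hfin hdeg hst hxy hadj hout hinf
  have hlt' : x' < y' := hxy'.trans_lt hyy'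
  have hinfv : ∀ {t}, G.Adj x' t → (G.connectedComponentMk t).supp.Infinite := fun h => by
    rwa [← SimpleGraph.ConnectedComponent.sound h.reachable]
  rcases lt_trichotomy y' v with hlt | rfl | hgt
  · exact absurd (hmax ⟨x', hux.trans hx', hlt', hlt, hadj', hout', hinf'⟩ hyy'.le)
      (not_le.2 hyy')
  · obtain ⟨q, hq, hxq⟩ := exists_right_continuation hfin hdeg hst (hux.trans hx') hlt' huv hadj'
      (hinfv hadj')
    exact absurd (hout' q hxq) (not_le.2 hq)
  · have hx'v : x' < v := hxy'.trans_lt hyv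
    rcases hst x' v hx'v with h | h | h
    · obtain ⟨a, b, hab, hh⟩ := hdeg x'
      have h1 := (hh z).1 hz
      have h2 := (hh v).1 h
      have h3 := (hh y').1 hadj'
      have h4 : z ≠ v := (hzy.trans_lt hyv).ne
      have h5 : z ≠ y' := (hzy.trans_lt hyy').ne
      have h6 : v ≠ y' := hgt.ne
      grind
    · exact absurd (h y' hlt' hadj') (not_le.2 hgt)
    · exact absurd (h u ((hux.trans hx').trans hx'v) huv) (not_le.2 (hux.trans hx'))

/-- In a stable graph with all degrees equal to two, an infinite component confines the edges: some
pair of points is not enclosed by any edge. -/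
lemma exists_not_enclosed (hfin : ∀ a b : V, (Set.Icc a b).Finite)
    (hdeg : ∀ x, ∃ u w, u ≠ w ∧ ∀ z, G.Adj x z ↔ z = u ∨ z = w)
    (hst : ∀ x y, x < y → G.Adj x y ∨ (∀ z, x < z → G.Adj x z → z ≤ y) ∨
      (∀ z, z < y → G.Adj z y → x ≤ z))
    (C : G.ConnectedComponent) (hC : C.supp.Infinite) :
    ∃ x y : V, x < y ∧ ∀ u v, u < x → y < v → ¬ G.Adj u v := by
  have hright : ∃ x y, x < y ∧ G.Adj x y ∧ (G.connectedComponentMk x).supp.Infinite := by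
    obtain ⟨x, hx⟩ := hC.nonempty
    rw [SimpleGraph.ConnectedComponent.mem_supp_iff] at hx
    obtain ⟨u, w, huw, h⟩ := hdeg x
    have hu : G.Adj x u := (h u).2 (Or.inl rfl)
    subst hx
    rcases lt_or_gt_of_ne hu.ne with hlt | hgt
    · exact ⟨x, u, hlt, hu, hC⟩
    · exact ⟨u, x, hgt, hu.symm, by rwa [← SimpleGraph.ConnectedComponent.sound hu.reachable]⟩
  obtain ⟨x, y, hxy, hadj, hinf⟩ := hright
  obtain ⟨w, hw⟩ : ∃ w, ∀ z, G.Adj x z ↔ z = y ∨ z = w := by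
    obtain ⟨u, w, huw, h⟩ := hdeg x
    rcases (h y).1 hadj with rfl | rfl
    · exact ⟨w, h⟩
    · exact ⟨u, fun z => by rw [h, or_comm]⟩
  have hadj' : G.Adj x (max y w) := by
    rcases max_choice y w with h | h <;> rw [h, hw] <;> simp
  refine ⟨x, max y w, hxy.trans_le (le_max_left _ _), fun u v hu hv =>
    not_enclosed hfin hdeg hst (hxy.trans_le (le_max_left _ _)) hadj' (fun z hz => ?_) hinf hu hv⟩
  rcases (hw z).1 hz with rfl | rfl
  · exact le_max_left _ _
  · exact le_max_right _ _

end Graph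

/-! ### Integer-valued measures -/

section Atoms

variable {E : Type*} [PseudoMetricSpace E] [MeasurableSpace E] {ν : Measure E}

/-- The measure is finite and integer-valued on bounded measurable sets. -/
def IsLocallyInteger {E : Type*} [PseudoMetricSpace E] [MeasurableSpace E] (ν : Measure E) : Prop :=
  ∀ B : Set E, MeasurableSet B → Bornology.IsBounded B → ∃ n : ℕ, ν B = n

lemma IsLocallyInteger.one_le (h : IsLocallyInteger ν) [MeasurableSingletonClass E] {x : E}
    (hx : x ∈ points ν) : 1 ≤ ν {x} := by
  obtain ⟨n, hn⟩ := h {x} (measurableSet_singleton x) Bornology.isBounded_singleton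
  have : 0 < ν {x} := hx
  rw [hn] at this ⊢
  exact_mod_cast this

/-- A bounded set of positive measure contains an atom: on a subset of minimal positive measure,
the measure takes only two values. -/
lemma IsLocallyInteger.exists_atom [MeasurableSpace.CountablySeparated E]
    (h : IsLocallyInteger ν) {B : Set E} (hBm : MeasurableSet B)
    (hB : Bornology.IsBounded B) (hpos : ν B ≠ 0) : ∃ x ∈ B, x ∈ points ν := by
  classical
  have hex : ∃ n : ℕ, n ≠ 0 ∧ ∃ C ⊆ B, MeasurableSet C ∧ ν C = n := by
    obtain ⟨n, hn⟩ := h B hBm hB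
    exact ⟨n, by rintro rfl; simp [hn] at hpos, B, subset_rfl, hBm, hn⟩
  obtain ⟨hn0, C, hCB, hCm, hC⟩ := Nat.find_spec hex
  set n := Nat.find hex
  have hCne : C.Nonempty := by
    rw [Set.nonempty_iff_ne_empty]
    rintro rfl
    simp at hC
    exact hn0 (by exact_mod_cast hC.symm)
  have hsep : HasCountableSeparatingOn E MeasurableSet C :=
    HasCountableSeparatingOn.mono (h := MeasurableSpace.CountablySeparated.countably_separated)
      (fun _ h => h) (Set.subset_univ C)
  have key : ∃ a ∈ C, {a} ∈ ae (ν.restrict C) := by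
    refine Filter.exists_mem_singleton_mem_of_mem_of_nonempty_of_forall_separating MeasurableSet
      (ae_restrict_mem hCm) hCne fun U hU => ?_
    obtain ⟨k, hk⟩ := h (C ∩ U) (hCm.inter hU) (hB.subset (Set.inter_subset_left.trans hCB))
    by_cases hk0 : k = 0
    · right
      rw [mem_ae_iff, compl_compl, Measure.restrict_apply hU, Set.inter_comm, hk, hk0]
      simp
    · left
      have h1 : n ≤ k := Nat.find_min' hex
        ⟨hk0, C ∩ U, Set.inter_subset_left.trans hCB, hCm.inter hU, hk⟩
      rw [mem_ae_iff, Measure.restrict_apply hU.compl, Set.inter_comm, ← Set.sdiff_eq,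
        ← Set.sdiff_inter_self_eq_sdiff, Set.inter_comm,
        measure_sdiff Set.inter_subset_left (hCm.inter hU).nullMeasurableSet (by simp [hk]), hC, hk]
      exact tsub_eq_zero_of_le (by exact_mod_cast h1)
  obtain ⟨a, haC, ha⟩ := key
  refine ⟨a, hCB haC, ?_⟩
  have h2 : ν (C \ {a}) = 0 := by
    rw [mem_ae_iff, Measure.restrict_apply' hCm] at ha
    rwa [Set.sdiff_eq, Set.inter_comm]
  have h3 : ν C ≤ ν {a} := by
    calc ν C ≤ ν (C \ {a} ∪ {a}) := measure_mono (by simp)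
      _ ≤ _ := measure_union_le _ _
      _ = _ := by rw [h2, zero_add]
  refine lt_of_lt_of_le ?_ h3
  rw [hC]
  exact_mod_cast Nat.pos_of_ne_zero hn0

variable [OpensMeasurableSpace E]

lemma IsLocallyInteger.ne_top (h : IsLocallyInteger ν) {B : Set E} (hB : Bornology.IsBounded B) :
    ν B ≠ ∞ := by
  obtain ⟨n, hn⟩ := h (closure B) isClosed_closure.measurableSet hB.closure
  exact ((measure_mono subset_closure).trans_lt (hn ▸ ENNReal.natCast_lt_top n)).ne

lemma IsLocallyInteger.finite_points [MeasurableSingletonClass E] (h : IsLocallyInteger ν)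
    {B : Set E} (hB : Bornology.IsBounded B) : (points ν ∩ B).Finite := by
  by_contra hinf
  obtain ⟨n, hn⟩ := ENNReal.exists_nat_gt (h.ne_top hB)
  obtain ⟨t, ht, htc⟩ := (show (points ν ∩ B).Infinite from hinf).exists_subset_card_eq n
  have h1 : (n : ℝ≥0∞) ≤ ν t := by
    rw [← sum_measure_singleton, ← htc, Finset.card_eq_sum_ones, Nat.cast_sum]
    exact Finset.sum_le_sum fun x hx => by simpa using h.one_le (ht hx).1
  exact absurd (h1.trans (measure_mono fun x hx => (ht hx).2)) (not_le.2 hn)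

lemma IsLocallyInteger.countable_points [MeasurableSingletonClass E] (h : IsLocallyInteger ν) :
    (points ν).Countable := by
  rcases isEmpty_or_nonempty E with _ | ⟨⟨x⟩⟩
  · exact Set.Subsingleton.countable (Set.subsingleton_of_subsingleton)
  have : points ν = ⋃ n : ℕ, points ν ∩ Metric.closedBall x n := by
    rw [← Set.inter_iUnion, Metric.iUnion_closedBall_nat, Set.inter_univ]
  rw [this]
  exact Set.countable_iUnion fun n => (h.finite_points Metric.isBounded_closedBall).countable

/-- A locally finite integer-valued measure is carried by its points. -/
lemma IsLocallyInteger.ae_mem_points [MeasurableSpace.CountablySeparated E]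
    [MeasurableSingletonClass E] (h : IsLocallyInteger ν) :
    ∀ᵐ x ∂ν, x ∈ points ν := by
  rcases isEmpty_or_nonempty E with _ | ⟨⟨x⟩⟩
  · exact Filter.Eventually.of_forall fun x => isEmptyElim x
  have : (points ν)ᶜ = ⋃ n : ℕ, (points ν)ᶜ ∩ Metric.closedBall x n := by
    rw [← Set.inter_iUnion, Metric.iUnion_closedBall_nat, Set.inter_univ]
  change ν (points ν)ᶜ = 0
  rw [this, measure_iUnion_null_iff]
  intro n
  by_contra h0
  obtain ⟨y, hy, hy'⟩ := h.exists_atom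
    (h.countable_points.measurableSet.compl.inter Metric.isClosed_closedBall.measurableSet)
    (Metric.isBounded_closedBall.subset Set.inter_subset_right) h0
  exact hy.1 hy'

end Atoms

/-! ### Anti-concentration of binomial sums -/

section Choose

lemma centralBinom_sq_mul_le (n : ℕ) : n.centralBinom ^ 2 * (2 * n + 1) ≤ 16 ^ n := by
  induction n with
  | zero => simp
  | succ n ih =>
    have h := Nat.succ_mul_centralBinom_succ n
    have h2 : (n + 1) ^ 2 * ((n + 1).centralBinom ^ 2 * (2 * (n + 1) + 1)) ≤
        (n + 1) ^ 2 * 16 ^ (n + 1) := by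
      calc (n + 1) ^ 2 * ((n + 1).centralBinom ^ 2 * (2 * (n + 1) + 1))
          = ((n + 1) * (n + 1).centralBinom) ^ 2 * (2 * n + 3) := by ring
        _ = (n.centralBinom ^ 2 * (2 * n + 1)) * (4 * (2 * n + 1) * (2 * n + 3)) := by
          rw [h]; ring
        _ ≤ 16 ^ n * (16 * (n + 1) ^ 2) := by
          gcongr ?_ * ?_
          nlinarith
        _ = _ := by ring
    exact Nat.le_of_mul_le_mul_left h2 (by positivity)

lemma choose_sq_mul_le (m s : ℕ) : m.choose s ^ 2 * m ≤ 4 ^ m := by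
  obtain ⟨n, rfl | rfl⟩ := m.even_or_odd'
  · calc (2 * n).choose s ^ 2 * (2 * n) ≤ n.centralBinom ^ 2 * (2 * n + 1) := by
          gcongr
          · exact Nat.choose_le_centralBinom s n
          · exact Nat.le_succ _
      _ ≤ 16 ^ n := centralBinom_sq_mul_le n
      _ = _ := by rw [pow_mul]; norm_num
  · have h : (2 * n + 1).choose s ≤ 2 * n.centralBinom := by
      cases s with
      | zero => have := n.centralBinom_pos; simp; omega
      | succ s =>
        rw [Nat.choose_succ_succ, two_mul n.centralBinom]
        exact add_le_add (Nat.choose_le_centralBinom _ _) (Nat.choose_le_centralBinom _ _)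
    calc (2 * n + 1).choose s ^ 2 * (2 * n + 1) ≤ (2 * n.centralBinom) ^ 2 * (2 * n + 1) := by
          gcongr
      _ = 4 * (n.centralBinom ^ 2 * (2 * n + 1)) := by ring
      _ ≤ 4 * 16 ^ n := by gcongr; exact centralBinom_sq_mul_le n
      _ = _ := by rw [pow_succ, pow_mul]; norm_num [mul_comm]

/-- The largest weight of the symmetric binomial law on `{0, …, m}` is at most `1 / √m`. -/
lemma choose_mul_inv_two_pow_le (m s : ℕ) (hm : m ≠ 0) :
    (m.choose s : ℝ≥0∞) * (2 ^ m)⁻¹ ≤ ENNReal.ofReal (1 / √m) := by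
  have h : (m.choose s : ℝ) * (2 ^ m)⁻¹ ≤ 1 / √m := by
    have hm' : (0 : ℝ) < m := by positivity
    rw [← div_eq_mul_inv, div_le_div_iff₀ (by positivity) (by positivity), one_mul]
    refine abs_le_of_sq_le_sq' ?_ (by positivity) |>.2
    rw [mul_pow, Real.sq_sqrt hm'.le, ← pow_mul, mul_comm m 2, pow_mul]
    norm_num
    exact_mod_cast choose_sq_mul_le m s
  calc (m.choose s : ℝ≥0∞) * (2 ^ m)⁻¹ = ENNReal.ofReal ((m.choose s : ℝ) * (2 ^ m)⁻¹) := by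
        rw [ENNReal.ofReal_mul (by positivity), ENNReal.ofReal_natCast,
          ENNReal.ofReal_inv_of_pos (by positivity), ENNReal.ofReal_pow (by norm_num)]
        norm_num
    _ ≤ _ := ENNReal.ofReal_le_ofReal h

/-- Vandermonde's identity for a family of binomial coefficients. -/
lemma tsum_prod_choose : ∀ (n : ℕ) (d : Fin n → ℕ) (s : ℕ),
    ∑' r : Fin n → ℕ, (if ∑ i, r i = s then ∏ i, ((d i).choose (r i) : ℝ≥0∞) else 0) =
      ((∑ i, d i).choose s : ℝ≥0∞) := by
  intro n
  induction n with
  | zero =>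
    intro d s
    rw [tsum_eq_single (fun i => i.elim0) (fun r hr => absurd (Subsingleton.elim _ _) hr)]
    cases s <;> simp
  | succ n ih =>
    intro d s
    rw [← (Fin.consEquiv fun _ => ℕ).tsum_eq, ENNReal.tsum_prod']
    simp only [Fin.consEquiv_apply, Fin.prod_univ_succ, Fin.sum_univ_succ, Fin.cons_zero,
      Fin.cons_succ]
    have h1 : ∀ a : ℕ, ∑' r : Fin n → ℕ, (if a + ∑ i, r i = s then
        ((d 0).choose a : ℝ≥0∞) * ∏ i, ((d i.succ).choose (r i) : ℝ≥0∞) else 0) =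
        if a ≤ s then ((d 0).choose a * (∑ i, d (Fin.succ i)).choose (s - a) : ℝ≥0∞) else 0 := by
      intro a
      split_ifs with h
      · rw [← ih, ← ENNReal.tsum_mul_left]
        refine tsum_congr fun r => ?_
        have : (a + ∑ i, r i = s) ↔ (∑ i, r i = s - a) := by omega
        simp only [this, mul_ite, mul_zero]
      · simp only [ENNReal.tsum_eq_zero, ite_eq_right_iff]
        intro r hr
        omega
    simp_rw [h1]
    rw [tsum_eq_sum (s := Finset.range (s + 1)) (fun a ha => if_neg (by simpa using ha)),
      Nat.add_choose_eq, Finset.Nat.sum_antidiagonal_eq_sum_range_succ_mk, Nat.cast_sum]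
    refine Finset.sum_congr rfl fun a ha => ?_
    rw [if_pos (by simpa [Nat.lt_succ_iff] using ha), Nat.cast_mul]

lemma binomial_half_singleton (n k : ℕ) :
    binomial n ⟨1 / 2, by norm_num, by norm_num⟩ {k} = (n.choose k : ℝ≥0∞) * (2 ^ n)⁻¹ := by
  rw [binomial_singleton]
  rcases le_or_gt k n with h | h
  · have : ((n.choose k : ℝ) * (1 / 2) ^ k * (1 - 1 / 2) ^ (n - k)) = n.choose k * (2 ^ n)⁻¹ := by
      rw [show (1 - 1 / 2 : ℝ) = 1 / 2 by norm_num, mul_assoc, ← pow_add, Nat.add_sub_cancel' h]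
      simp
    simp only [this]
    rw [ENNReal.ofReal_mul (by positivity), ENNReal.ofReal_natCast,
      ENNReal.ofReal_inv_of_pos (by positivity), ENNReal.ofReal_pow (by norm_num)]
    norm_num
  · simp [Nat.choose_eq_zero_of_lt h]

/-- Anti-concentration of a sum of independent symmetric binomial variables. -/
lemma tsum_prod_binomial_le {n : ℕ} (hn : n ≠ 0) (d : Fin n → ℕ) (hd : ∀ i, d i ≠ 0) (s : ℕ) :
    ∑' r : Fin n → ℕ, (if ∑ i, r i = s then
      ∏ i, binomial (d i) ⟨1 / 2, by norm_num, by norm_num⟩ {r i} else 0) ≤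
      ENNReal.ofReal (1 / √n) := by
  have hsum : n ≤ ∑ i, d i := by
    calc n = ∑ _i : Fin n, 1 := by simp
      _ ≤ _ := Finset.sum_le_sum fun i _ => Nat.one_le_iff_ne_zero.2 (hd i)
  have h1 : ∀ r : Fin n → ℕ, (if ∑ i, r i = s then
      ∏ i, binomial (d i) ⟨1 / 2, by norm_num, by norm_num⟩ {r i} else 0) =
      (if ∑ i, r i = s then ∏ i, ((d i).choose (r i) : ℝ≥0∞) else 0) * (2 ^ ∑ i, d i)⁻¹ := by
    intro r
    split_ifs
    · simp_rw [binomial_half_singleton, Finset.prod_mul_distrib]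
      congr 1
      rw [← Finset.prod_pow_eq_pow_sum, ENNReal.prod_inv_distrib]
      intro i _ j _ _
      left
      positivity
    · simp
  simp_rw [h1]
  rw [ENNReal.tsum_mul_right, tsum_prod_choose]
  refine (choose_mul_inv_two_pow_le _ _ (by omega)).trans (ENNReal.ofReal_le_ofReal ?_)
  gcongr

end Choose

/-! ### Measurable enumeration of points -/

section Enumeration

/-- The position of the `i`-th point (counted from `0`) of `ν` in `[a, b)`, and `b` if there is no
such point. The infimum over rational positions makes it a measurable function of `ν`. -/
noncomputable def nthPoint (a b : ℝ) (i : ℕ) (ν : Measure ℝ) : ℝ :=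
  open Classical in
  ⨅ q : ℚ, if a ≤ q ∧ q ≤ b ∧ ((i + 1 : ℕ) : ℝ≥0∞) ≤ ν (Set.Ico a q) then (q : ℝ) else b

lemma measurable_nthPoint (a b : ℝ) (i : ℕ) : Measurable (nthPoint a b i) := by
  classical
  unfold nthPoint
  refine Measurable.iInf fun q => Measurable.ite ?_ measurable_const measurable_const
  refine (MeasurableSet.const _).inter ((MeasurableSet.const _).inter ?_)
  exact measurableSet_le measurable_const (Measure.measurable_coe measurableSet_Ico)

variable {ν : Measure ℝ}

lemma IsLocallyInteger.measure_eq_zero (h : IsLocallyInteger ν) {B : Set ℝ}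
    (hB : ∀ x ∈ B, x ∉ points ν) : ν B = 0 :=
  measure_mono_null (fun x hx => hB x hx) h.ae_mem_points

lemma IsLocallyInteger.exists_isolating (h : IsLocallyInteger ν) (x : ℝ) :
    ∃ δ > 0, ∀ y, |y - x| < δ → y ≠ x → y ∉ points ν := by
  have hfin : ((points ν ∩ Metric.ball x 1) \ {x}).Finite :=
    (h.finite_points Metric.isBounded_ball).sdiff
  have : ((points ν ∩ Metric.ball x 1) \ {x})ᶜ ∈ nhds x :=
    hfin.isClosed.isOpen_compl.mem_nhds (by simp)
  obtain ⟨δ, hδ, hsub⟩ := Metric.mem_nhds_iff.1 this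
  refine ⟨min δ 1, by positivity, fun y hy hyx hyp => ?_⟩
  have := hsub (show y ∈ Metric.ball x δ by
    rw [Metric.mem_ball, Real.dist_eq]; exact hy.trans_le (min_le_left _ _))
  refine this ⟨⟨hyp, ?_⟩, hyx⟩
  rw [Metric.mem_ball, Real.dist_eq]
  exact hy.trans_le (min_le_right _ _)

/-- The `i`-th point is a point of `ν`, and it has `i` points of `[a, b)` to its left. -/
lemma nthPoint_spec (h : IsLocallyInteger ν) (hs : ∀ x, ν {x} ≤ 1) {a b : ℝ} (hab : a < b)
    {n i : ℕ} (hn : ν (Set.Ico a b) = n) (hi : i < n) :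
    nthPoint a b i ν ∈ points ν ∧ nthPoint a b i ν ∈ Set.Ico a b ∧
      ν (Set.Ico a (nthPoint a b i ν)) = i := by
  classical
  set x := nthPoint a b i ν with hx
  set f : ℚ → ℝ := fun q =>
    if a ≤ q ∧ q ≤ b ∧ ((i + 1 : ℕ) : ℝ≥0∞) ≤ ν (Set.Ico a q) then (q : ℝ) else b
    with hf
  have hxf : x = ⨅ q, f q := by
    rw [hx, nthPoint]
  have hfa : ∀ q, a ≤ f q := by
    intro q
    simp only [hf]
    split_ifs with hq
    · exact hq.1
    · exact hab.le
  have hfb : ∀ q, f q ≤ b := by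
    intro q
    simp only [hf]
    split_ifs with hq
    · exact hq.2.1
    · exact le_rfl
  have hbdd : BddBelow (Set.range f) := ⟨a, by rintro _ ⟨q, rfl⟩; exact hfa q⟩
  have hax : a ≤ x := hxf ▸ le_ciInf hfa
  have hxb : x ≤ b := hxf ▸ (ciInf_le hbdd 0).trans (hfb 0)
  -- `x` is where the number of points in `[a, ·)` jumps above `i`
  have hlow : ∀ q : ℚ, a ≤ q → (q : ℝ) < x → ν (Set.Ico a q) < ((i + 1 : ℕ) : ℝ≥0∞) := by
    intro q haq hqx
    by_contra! hc
    have h1 : f q = q := if_pos ⟨haq, (hqx.trans_le hxb).le, hc⟩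
    have h2 := ciInf_le hbdd q
    rw [← hxf, h1] at h2
    exact absurd h2 (not_le.2 hqx)
  have hupp : ∀ c : ℝ, x < c → c ≤ b → ((i + 1 : ℕ) : ℝ≥0∞) ≤ ν (Set.Ico a c) := by
    intro c hxc hcb
    rw [hxf] at hxc
    obtain ⟨q, hq⟩ := exists_lt_of_ciInf_lt hxc
    simp only [hf] at hq
    split_ifs at hq with hc
    · exact hc.2.2.trans (measure_mono (Set.Ico_subset_Ico_right hq.le))
    · exact absurd hq (not_lt.2 hcb)
  obtain ⟨δ, hδ, hiso⟩ := h.exists_isolating x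
  have hleft : ∀ q : ℝ, a ≤ q → x - δ < q → q ≤ x → ν (Set.Ico a x) = ν (Set.Ico a q) := by
    intro q haq h1 h2
    rw [← Set.Ico_union_Ico_eq_Ico haq h2, measure_union (Set.Ico_disjoint_Ico_same)
      measurableSet_Ico, h.measure_eq_zero (B := Set.Ico q x), add_zero]
    rintro y ⟨hy1, hy2⟩
    exact hiso y (by rw [abs_lt]; constructor <;> linarith) hy2.ne
  have hlefti : ν (Set.Ico a x) < ((i + 1 : ℕ) : ℝ≥0∞) := by
    rcases hax.eq_or_lt with hax | hax
    · rw [← hax]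
      simp only [Set.Ico_self, measure_empty]
      exact_mod_cast Nat.succ_pos i
    · obtain ⟨q, hq1, hq2⟩ := exists_rat_btwn (show max a (x - δ) < x by simp [hax, hδ])
      rw [max_lt_iff] at hq1
      rw [hleft q hq1.1.le hq1.2 hq2.le]
      exact hlow q hq1.1.le hq2
  have hxltb : x < b := by
    refine lt_of_le_of_ne hxb fun hxb => ?_
    rw [hxb, hn] at hlefti
    have : n < i + 1 := by exact_mod_cast hlefti
    omega
  have hright : ((i + 1 : ℕ) : ℝ≥0∞) ≤ ν (Set.Icc a x) := by
    obtain ⟨q, hq1, hq2⟩ := exists_between (show x < min b (x + δ) by simp [hxltb, hδ])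
    rw [lt_min_iff] at hq2
    refine (hupp q hq1 hq2.1.le).trans ?_
    have : Set.Ico a q ⊆ Set.Icc a x ∪ Set.Ioo x q := by
      intro y hy
      rcases le_or_gt y x with h | h
      · exact Or.inl ⟨hy.1, h⟩
      · exact Or.inr ⟨h, hy.2⟩
    refine (measure_mono this).trans ((measure_union_le _ _).trans ?_)
    rw [h.measure_eq_zero (B := Set.Ioo x q), add_zero]
    rintro y ⟨hy1, hy2⟩
    exact hiso y (by rw [abs_lt]; constructor <;> linarith) hy1.ne'
  have hsplit : ν (Set.Icc a x) = ν (Set.Ico a x) + ν {x} := by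
    rw [← Set.Ico_union_right hax, measure_union _ (measurableSet_singleton x)]
    simp
  obtain ⟨k, hk⟩ := h (Set.Ico a x) measurableSet_Ico (Metric.isBounded_Ico a x)
  rw [hk] at hlefti hsplit ⊢
  have hki : k < i + 1 := by exact_mod_cast hlefti
  have hik : i + 1 ≤ k + 1 := by
    have : ((i + 1 : ℕ) : ℝ≥0∞) ≤ ((k + 1 : ℕ) : ℝ≥0∞) := by
      rw [hsplit] at hright
      refine hright.trans ?_
      push_cast
      gcongr
      exact hs x
    exact_mod_cast this
  refine ⟨?_, ⟨hax, hxltb⟩, by rw [show k = i by omega]⟩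
  rw [points, Set.mem_ofPred_eq, pos_iff_ne_zero]
  intro h0
  rw [hsplit, h0, add_zero] at hright
  have : i + 1 ≤ k := by exact_mod_cast hright
  omega

/-- `nthPoint` enumerates the points of `ν` in `[a, b)`. -/
lemma exists_nthPoint_eq (h : IsLocallyInteger ν) (hs : ∀ x, ν {x} ≤ 1) {a b : ℝ} (hab : a < b)
    {n : ℕ} (hn : ν (Set.Ico a b) = n) {x : ℝ} (hx : x ∈ points ν) (hxI : x ∈ Set.Ico a b) :
    ∃ i < n, nthPoint a b i ν = x := by
  have hlt : ∀ u v : ℝ, a ≤ u → u < v → u ∈ points ν → ν (Set.Ico a u) + 1 ≤ ν (Set.Ico a v) := by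
    intro u v hau huv hu
    calc ν (Set.Ico a u) + 1 ≤ ν (Set.Ico a u) + ν {u} := by gcongr; exact h.one_le hu
      _ = ν (Set.Icc a u) := by
        rw [← Set.Ico_union_right hau, measure_union _ (measurableSet_singleton u)]
        simp
      _ ≤ _ := measure_mono (show Set.Icc a u ⊆ Set.Ico a v from
        fun y hy => ⟨hy.1, hy.2.trans_lt huv⟩)
  obtain ⟨k, hk⟩ := h (Set.Ico a x) measurableSet_Ico (Metric.isBounded_Ico a x)
  have hkn : k < n := by
    have := hlt x b hxI.1 hxI.2 hx
    rw [hk, hn] at this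
    exact_mod_cast this
  obtain ⟨h1, h2, h3⟩ := nthPoint_spec h hs hab hn hkn
  refine ⟨k, hkn, ?_⟩
  rcases lt_trichotomy (nthPoint a b k ν) x with hc | hc | hc
  · have := hlt _ x h2.1 hc h1
    rw [h3, hk] at this
    have : k + 1 ≤ k := by exact_mod_cast this
    omega
  · exact hc
  · have := hlt x _ hxI.1 hc hx
    rw [h3, hk] at this
    have : k + 1 ≤ k := by exact_mod_cast this
    omega

lemma nthPoint_injective (h : IsLocallyInteger ν) (hs : ∀ x, ν {x} ≤ 1) {a b : ℝ} (hab : a < b)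
    {n : ℕ} (hn : ν (Set.Ico a b) = n) :
    Function.Injective fun i : Fin n => nthPoint a b i ν := by
  intro i j hij
  have hi := (nthPoint_spec h hs hab hn i.2).2.2
  have hj := (nthPoint_spec h hs hab hn j.2).2.2
  simp only at hij
  rw [hij, hj] at hi
  exact Fin.ext (by exact_mod_cast hi.symm)

end Enumeration

/-! ### The Poisson process -/

section Poisson

lemma poissonMeasure_two_le (r : ℝ≥0) :
    poissonMeasure r {n | 2 ≤ n} ≤ ENNReal.ofReal ((r : ℝ) ^ 2) := by
  have h : {n : ℕ | 2 ≤ n} = (({0, 1} : Finset ℕ) : Set ℕ)ᶜ := by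
    ext n
    simp
    omega
  have h0 : Real.exp (-r) + Real.exp (-r) * r ≤ 1 := by
    have := Real.add_one_le_exp (r : ℝ)
    rw [Real.exp_neg, ← mul_one_add, inv_mul_le_iff₀ (Real.exp_pos _)]
    linarith
  rw [h, prob_compl_eq_one_sub (Finset.measurableSet _), ← sum_measure_singleton]
  simp only [poissonMeasure_singleton]
  rw [Finset.sum_pair (by norm_num), ← ENNReal.ofReal_add (by positivity) (by positivity),
    ← ENNReal.ofReal_one, ← ENNReal.ofReal_sub _ (by positivity)]
  refine ENNReal.ofReal_le_ofReal ?_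
  have h1 := Real.add_one_le_exp (-(r : ℝ))
  have h2 : (0 : ℝ) ≤ r := r.2
  simp
  nlinarith

/-- A Chernoff bound for the lower tail of the Poisson law. -/
lemma poissonMeasure_lt_le (r : ℝ≥0) (m : ℕ) :
    poissonMeasure r {n | n < m} ≤ ENNReal.ofReal (2 ^ m * Real.exp (-(r / 2 : ℝ))) := by
  have h : {n : ℕ | n < m} = ((Finset.range m : Finset ℕ) : Set ℕ) := by
    ext n
    simp
  rw [h, ← sum_measure_singleton]
  simp only [poissonMeasure_singleton]
  rw [← ENNReal.ofReal_sum_of_nonneg fun _ _ => by positivity]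
  refine ENNReal.ofReal_le_ofReal ?_
  have hr : (0 : ℝ) ≤ r := r.2
  calc ∑ n ∈ Finset.range m, Real.exp (-r) * (r : ℝ) ^ n / n.factorial
      ≤ ∑ n ∈ Finset.range m, 2 ^ m * Real.exp (-r) * ((r / 2 : ℝ) ^ n / n.factorial) := by
        refine Finset.sum_le_sum fun n hn => ?_
        have h1 : (1 : ℝ) ≤ 2 ^ m / 2 ^ n := by
          rw [one_le_div (by positivity)]
          exact pow_le_pow_right₀ (by norm_num) (Finset.mem_range.1 hn).le
        calc Real.exp (-r) * (r : ℝ) ^ n / n.factorial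
            = 1 * (Real.exp (-r) * (r : ℝ) ^ n / n.factorial) := by ring
          _ ≤ (2 ^ m / 2 ^ n) * (Real.exp (-r) * (r : ℝ) ^ n / n.factorial) := by gcongr
          _ = _ := by rw [div_pow]; ring
    _ = 2 ^ m * Real.exp (-r) * ∑ n ∈ Finset.range m, ((r / 2 : ℝ) ^ n / n.factorial) := by
        rw [Finset.mul_sum]
    _ ≤ 2 ^ m * Real.exp (-r) * Real.exp (r / 2) := by
        gcongr
        exact Real.sum_le_exp_of_nonneg (by positivity) m
    _ = _ := by
        rw [mul_assoc, ← Real.exp_add]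
        ring_nf

lemma lintegral_natCast_poissonMeasure_ne_top (r : ℝ≥0) :
    ∫⁻ n : ℕ, (n : ℝ≥0∞) ∂poissonMeasure r ≠ ∞ := by
  rw [lintegral_countable']
  have hs : Summable fun n : ℕ => Real.exp (-r) * ((2 * r : ℝ) ^ n / n.factorial) :=
    (Real.summable_pow_div_factorial _).mul_left _
  refine ne_top_of_le_ne_top hs.tsum_ofReal_ne_top (ENNReal.tsum_le_tsum fun n => ?_)
  rw [poissonMeasure_singleton, ← ENNReal.ofReal_natCast, ← ENNReal.ofReal_mul (by positivity)]
  refine ENNReal.ofReal_le_ofReal ?_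
  have h1 : (n : ℝ) ≤ 2 ^ n := by exact_mod_cast Nat.lt_two_pow_self.le
  calc (n : ℝ) * (Real.exp (-r) * (r : ℝ) ^ n / n.factorial)
      ≤ 2 ^ n * (Real.exp (-r) * (r : ℝ) ^ n / n.factorial) := by gcongr
    _ = _ := by rw [mul_pow]; ring

variable {Ω : Type*} [MeasurableSpace Ω] {P : Measure Ω} {N : Ω → Measure ℝ}

lemma IsPoissonProcess.prob_Ico (hN : IsPoissonProcess P N) (a b : ℝ) {S : Set ℝ≥0∞}
    (hS : MeasurableSet S) :
    P {ω | N ω (Set.Ico a b) ∈ S} =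
      poissonMeasure (b - a).toNNReal {n : ℕ | (n : ℝ≥0∞) ∈ S} := by
  have h := congrArg (fun m => m S) (hN.law (Set.Ico a b) measurableSet_Ico (by simp))
  beta_reduce at h
  have hm : Measurable fun ω => N ω (Set.Ico a b) :=
    (Measure.measurable_coe measurableSet_Ico).comp hN.measurable
  rw [Measure.map_apply hm hS,
    Measure.map_apply measurable_from_top hS, Real.volume_Ico] at h
  exact h

lemma IsPoissonProcess.prob_Ico_lt_le (hN : IsPoissonProcess P N) (T m : ℕ) :
    P {ω | N ω (Set.Ico 0 (T : ℝ)) < m} ≤ ENNReal.ofReal (2 ^ m * Real.exp (-(T / 2 : ℝ))) := by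
  have h := hN.prob_Ico 0 T (S := Set.Iio (m : ℝ≥0∞)) measurableSet_Iio
  simp only [Set.mem_Iio, Nat.cast_lt] at h
  rw [h]
  refine (poissonMeasure_lt_le _ m).trans_eq ?_
  simp

lemma IsPoissonProcess.lintegral_Ico_ne_top (hN : IsPoissonProcess P N) :
    ∫⁻ ω, N ω (Set.Ico 0 1) ∂P ≠ ∞ := by
  have h := hN.law (Set.Ico 0 1) measurableSet_Ico (by simp)
  have h2 : ∫⁻ ω, N ω (Set.Ico 0 1) ∂P = ∫⁻ x, x ∂(P.map fun ω => N ω (Set.Ico 0 1)) :=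
    (lintegral_map measurable_id
      ((Measure.measurable_coe measurableSet_Ico).comp hN.measurable)).symm
  rw [h2, h, lintegral_map (f := fun x => x) measurable_id measurable_from_top]
  exact lintegral_natCast_poissonMeasure_ne_top _

/-- A Poisson process has no multiple points: divide an interval of length one into `m` pieces, each
of which has at least two points with probability at most `1 / m ^ 2`. -/
lemma IsPoissonProcess.ae_simple (hN : IsPoissonProcess P N) : ∀ᵐ ω ∂P, ∀ x, N ω {x} ≤ 1 := by
  have hint : ∀ k : ℤ, ∀ᵐ ω ∂P, ∀ x ∈ Set.Ico (k : ℝ) (k + 1), N ω (Set.Icc x x) < 2 := by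
    intro k
    rw [ae_iff]
    have hle : ∀ m : ℕ, P {ω | ¬ ∀ x ∈ Set.Ico (k : ℝ) (k + 1), N ω (Set.Icc x x) < 2} ≤
        ENNReal.ofReal (1 / ((m : ℝ) + 1)) := by
      intro m
      set J : ℕ → Set ℝ := fun i => Set.Ico (k + i / (m + 1) : ℝ) (k + (i + 1) / (m + 1)) with hJ
      calc P {ω | ¬ ∀ x ∈ Set.Ico (k : ℝ) (k + 1), N ω (Set.Icc x x) < 2}
          ≤ P (⋃ i ∈ Finset.range (m + 1), {ω | N ω (J i) ∈ Set.Ici 2}) := by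
            refine measure_mono fun ω hω => ?_
            simp only [Set.mem_ofPred_eq, not_forall, not_lt] at hω
            obtain ⟨x, hx, hx2⟩ := hω
            have hm : (0 : ℝ) < m + 1 := by positivity
            have h0 : 0 ≤ (x - k) * (m + 1) := mul_nonneg (by linarith [hx.1]) hm.le
            have hfl := Nat.floor_le h0
            have hfl2 := Nat.lt_floor_add_one ((x - k) * (m + 1))
            simp only [Set.mem_iUnion]
            refine ⟨⌊(x - k) * (m + 1)⌋₊, ?_, ?_⟩
            · rw [Finset.mem_range, Nat.floor_lt h0]
              push_cast
              nlinarith [hx.2]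
            · refine le_trans hx2 (measure_mono ?_)
              rw [Set.Icc_self, Set.singleton_subset_iff]
              constructor
              · rw [← le_sub_iff_add_le', div_le_iff₀ hm]
                exact hfl
              · rw [← sub_lt_iff_lt_add', lt_div_iff₀ hm]
                exact hfl2
        _ ≤ ∑ i ∈ Finset.range (m + 1), P {ω | N ω (J i) ∈ Set.Ici 2} :=
            measure_biUnion_finset_le _ _
        _ ≤ ∑ i ∈ Finset.range (m + 1), ENNReal.ofReal ((1 / ((m : ℝ) + 1)) ^ 2) := by
            refine Finset.sum_le_sum fun i _ => ?_
            rw [hN.prob_Ico _ _ measurableSet_Ici]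
            have : {n : ℕ | (n : ℝ≥0∞) ∈ Set.Ici 2} = {n | 2 ≤ n} := by
              ext n
              simp
            rw [this]
            refine (poissonMeasure_two_le _).trans_eq ?_
            congr 2
            rw [Real.coe_toNNReal']
            have : (k + ((i : ℝ) + 1) / (m + 1) - (k + i / (m + 1)) : ℝ) = 1 / (m + 1) := by ring
            rw [this]
            exact max_eq_left (by positivity)
        _ = _ := by
            rw [Finset.sum_const, Finset.card_range, nsmul_eq_mul, ← ENNReal.ofReal_natCast,
              ← ENNReal.ofReal_mul (by positivity)]
            congr 1
            push_cast
            field_simp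
    have hlim := (ENNReal.continuous_ofReal.tendsto 0).comp
      (tendsto_one_div_add_atTop_nhds_zero_nat (𝕜 := ℝ))
    rw [ENNReal.ofReal_zero] at hlim
    exact le_antisymm (ge_of_tendsto' hlim hle) zero_le
  filter_upwards [ae_all_iff.2 hint, hN.integer_valued] with ω h hi x
  have h1 := h ⌊x⌋ x ⟨Int.floor_le x, Int.lt_floor_add_one x⟩
  rw [Set.Icc_self] at h1
  obtain ⟨n, hn⟩ := hi {x} (measurableSet_singleton x) Bornology.isBounded_singleton
  rw [hn] at h1 ⊢
  have : n < 2 := by exact_mod_cast h1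
  exact_mod_cast Nat.lt_succ_iff.1 this

end Poisson

/-! ### Stub counting -/

section Configurations

/-- The almost sure properties of a realisation `(π, ξ, ψ, m)` of points, degrees, numbers of
right-edges and edges. -/
structure IsStableConfig (π ξ ψ : Measure ℝ) (m : Measure (ℝ × ℝ)) : Prop where
  points_int : IsLocallyInteger π
  points_simple : ∀ x, π {x} ≤ 1
  degrees_int : IsLocallyInteger ξ
  rights_int : IsLocallyInteger ψ
  edges_int : IsLocallyInteger m
  ordered : ∀ p ∈ points m, p.1 < p.2
  simple : ∀ p, m {p} ≤ 1
  endpoints : ∀ p ∈ points m, p.1 ∈ points π ∧ p.2 ∈ points π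
  degree : ∀ x ∈ points π, m {p | p.1 = x ∨ p.2 = x} = ξ {x}
  right_degree : ∀ x ∈ points π, m {p | p.1 = x} = ψ {x}
  stable : ∀ x ∈ points π, ∀ y ∈ points π, x < y →
    (x, y) ∈ points m ∨
    (∀ z, (x, z) ∈ points m → |x - z| ≤ |x - y|) ∨
    (∀ z, (z, y) ∈ points m → |z - y| ≤ |x - y|)

lemma IsRandomDirectionStable.ae_isStableConfig {Ω : Type*} [MeasurableSpace Ω] {P : Measure Ω}
    {μ : Measure ℕ} {N ξ ψ : Ω → Measure ℝ} {M : Ω → Measure (ℝ × ℝ)}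
    (hN : IsPoissonProcess P N) (hξ : IsDegreeProcess P N ξ μ)
    (hψ : IsDirectionProcess P N ξ ψ) (hM : IsRandomDirectionStable P N ξ ψ M) :
    ∀ᵐ ω ∂P, IsStableConfig (N ω) (ξ ω) (ψ ω) (M ω) := by
  filter_upwards [hN.integer_valued, hN.ae_simple, hξ.integer_valued, hψ.integer_valued,
    hM.integer_valued, hM.ordered, hM.simple, hM.endpoints, hM.degree, hM.right_degree,
    hM.stable] with ω h1 h2 h3 h4 h5 h6 h7 h8 h9 h10 h11
  exact ⟨h1, h2, h3, h4, h5, h6, h7, h8, h9, h10, h11⟩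

variable {π ξ ψ : Measure ℝ} {m : Measure (ℝ × ℝ)}

lemma IsStableConfig.degree_eq_add (h : IsStableConfig π ξ ψ m) {x : ℝ} (hx : x ∈ points π) :
    ξ {x} = m {p | p.1 = x} + m {p | p.2 = x} := by
  have h1 : m ({p | p.1 = x} ∩ {p | p.2 = x}) = 0 := by
    refine measure_mono_null (fun p hp => ?_) h.edges_int.ae_mem_points
    intro hpm
    exact (h.ordered p hpm).ne (hp.1.trans hp.2.symm)
  rw [← measure_union_add_inter _ (measurableSet_eq_fun measurable_snd measurable_const), h1,
    add_zero, ← h.degree x hx]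
  rfl

/-- Edges with a given kind of end in `[a, b)` are counted point by point. -/
lemma IsStableConfig.measure_Ico_eq_sum (h : IsStableConfig π ξ ψ m) {a b : ℝ} (hab : a < b)
    {n : ℕ} (hn : π (Set.Ico a b) = n) {e : ℝ × ℝ → ℝ} (he : Measurable e)
    (hep : ∀ p ∈ points m, e p ∈ points π) :
    m {p | e p ∈ Set.Ico a b} = ∑ i : Fin n, m {p | e p = nthPoint a b i π} := by
  have hinj := nthPoint_injective h.points_int h.points_simple hab hn
  rw [← tsum_fintype (L := SummationFilter.unconditional _), ← measure_iUnion]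
  · refine measure_congr ?_
    filter_upwards [h.edges_int.ae_mem_points] with p hp
    refine propext ?_
    change e p ∈ Set.Ico a b ↔ p ∈ ⋃ i : Fin n, {p | e p = nthPoint a b i π}
    rw [Set.mem_iUnion]
    constructor
    · intro hpI
      obtain ⟨i, hi, hi'⟩ :=
        exists_nthPoint_eq h.points_int h.points_simple hab hn (hep p hp) hpI
      exact ⟨⟨i, hi⟩, hi'.symm⟩
    · rintro ⟨i, hi⟩
      have hi' : e p = nthPoint a b i π := hi
      rw [hi']
      exact (nthPoint_spec h.points_int h.points_simple hab hn i.2).2.1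
  · intro i j hij
    refine Set.disjoint_left.2 fun p hp hq => hij (hinj ?_)
    have hp' : e p = nthPoint a b i π := hp
    have hq' : e p = nthPoint a b j π := hq
    exact hp'.symm.trans hq'
  · exact fun i => measurableSet_eq_fun he measurable_const

/-- The edges leading from `[0, T)` to the right of this interval. -/
def outEdges (T : ℝ) : Set (ℝ × ℝ) := {p | p.1 ∈ Set.Ico 0 T ∧ T ≤ p.2}

/-- The edges leading from the left of `[0, T)` into this interval. -/
def inEdges (T : ℝ) : Set (ℝ × ℝ) := {p | p.1 < 0 ∧ p.2 ∈ Set.Ico 0 T}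

lemma measurableSet_outEdges (T : ℝ) : MeasurableSet (outEdges T) :=
  (measurable_fst measurableSet_Ico).inter (measurable_snd measurableSet_Ici)

lemma measurableSet_inEdges (T : ℝ) : MeasurableSet (inEdges T) :=
  (measurable_fst measurableSet_Iio).inter (measurable_snd measurableSet_Ico)

/-- The realisations for which `[0, T)` contains points with degrees `d` and numbers of right-edges
`r` such that the number of right-stubs and the number of left-stubs differ by at most `K`. -/
def IsBalanced (T : ℝ) (K : ℕ) (π ξ ψ : Measure ℝ) : Prop :=
  ∃ n : ℕ, π (Set.Ico 0 T) = n ∧ ∃ d r : Fin n → ℕ,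
    (∀ i : Fin n, ξ {nthPoint 0 T i π} = d i ∧ ψ {nthPoint 0 T i π} = r i) ∧
    |∑ i : Fin n, (2 * (r i : ℤ) - d i)| ≤ K

/-- Counting stubs: if at most `K` edges leave `[0, T)` to the right and at most `K` edges enter it
from the left, then the numbers of right- and left-stubs in it differ by at most `K`. -/
lemma IsStableConfig.isBalanced (h : IsStableConfig π ξ ψ m) {T : ℝ} (hT : 0 < T) {K : ℕ}
    (hout : m (outEdges T) ≤ K) (hin : m (inEdges T) ≤ K) : IsBalanced T K π ξ ψ := by
  obtain ⟨n, hn⟩ := h.points_int (Set.Ico 0 T) measurableSet_Ico (Metric.isBounded_Ico _ _)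
  have hd : ∀ x, ∃ k : ℕ, ξ {x} = k := fun x =>
    h.degrees_int {x} (measurableSet_singleton x) Bornology.isBounded_singleton
  have hr : ∀ x, ∃ k : ℕ, ψ {x} = k := fun x =>
    h.rights_int {x} (measurableSet_singleton x) Bornology.isBounded_singleton
  choose d hd using hd
  choose r hr using hr
  refine ⟨n, hn, fun i => d (nthPoint 0 T i π), fun i => r (nthPoint 0 T i π),
    fun i => ⟨hd _, hr _⟩, ?_⟩
  have hpt : ∀ i : Fin n, nthPoint 0 T i π ∈ points π := fun i =>
    (nthPoint_spec h.points_int h.points_simple hT hn i.2).1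
  have h1 := h.measure_Ico_eq_sum hT hn measurable_fst (fun p hp => (h.endpoints p hp).1)
  have h2 := h.measure_Ico_eq_sum hT hn measurable_snd (fun p hp => (h.endpoints p hp).2)
  have hR : m {p | p.1 ∈ Set.Ico 0 T} = ((∑ i : Fin n, r (nthPoint 0 T i π) : ℕ) : ℝ≥0∞) := by
    rw [h1, Nat.cast_sum]
    exact Finset.sum_congr rfl fun i _ => by rw [h.right_degree _ (hpt i), hr]
  have hD : m {p | p.1 ∈ Set.Ico 0 T} + m {p | p.2 ∈ Set.Ico 0 T} =
      ((∑ i : Fin n, d (nthPoint 0 T i π) : ℕ) : ℝ≥0∞) := by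
    rw [h1, h2, Nat.cast_sum, ← Finset.sum_add_distrib]
    exact Finset.sum_congr rfl fun i _ => by rw [← h.degree_eq_add (hpt i), hd]
  set J : Set (ℝ × ℝ) := {p | p.1 ∈ Set.Ico 0 T ∧ p.2 ∈ Set.Ico 0 T}
  have hJ : MeasurableSet J :=
    (measurable_fst measurableSet_Ico).inter (measurable_snd measurableSet_Ico)
  have e1 : m {p | p.1 ∈ Set.Ico 0 T} = m (outEdges T) + m J := by
    rw [← measure_union _ hJ]
    · refine measure_congr ?_
      filter_upwards [h.edges_int.ae_mem_points] with p hp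
      refine propext ?_
      change p.1 ∈ Set.Ico 0 T ↔ (p.1 ∈ Set.Ico 0 T ∧ T ≤ p.2) ∨
        (p.1 ∈ Set.Ico 0 T ∧ p.2 ∈ Set.Ico 0 T)
      have := h.ordered p hp
      simp only [Set.mem_Ico]
      grind
    · exact Set.disjoint_left.2 fun p hp hq => absurd hp.2 (not_le.2 hq.2.2)
  have e2 : m {p | p.2 ∈ Set.Ico 0 T} = m (inEdges T) + m J := by
    rw [← measure_union _ hJ]
    · refine measure_congr ?_
      filter_upwards [h.edges_int.ae_mem_points] with p hp
      refine propext ?_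
      change p.2 ∈ Set.Ico 0 T ↔ (p.1 < 0 ∧ p.2 ∈ Set.Ico 0 T) ∨
        (p.1 ∈ Set.Ico 0 T ∧ p.2 ∈ Set.Ico 0 T)
      have := h.ordered p hp
      simp only [Set.mem_Ico]
      grind
    · exact Set.disjoint_left.2 fun p hp hq => absurd hp.1 (not_lt.2 hq.1.1)
  set R := ∑ i : Fin n, r (nthPoint 0 T i π)
  set D := ∑ i : Fin n, d (nthPoint 0 T i π)
  have i1 : 2 * R ≤ D + K := by
    have : (2 * R : ℝ≥0∞) ≤ D + K := by
      calc (2 * R : ℝ≥0∞) = 2 * (m (outEdges T) + m J) := by rw [← hR, e1]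
        _ ≤ 2 * (m (outEdges T) + m J) + m (inEdges T) := le_self_add
        _ = D + m (outEdges T) := by rw [← hD, e1, e2]; ring
        _ ≤ _ := by gcongr
    exact_mod_cast this
  have i2 : D ≤ 2 * R + K := by
    have : (D : ℝ≥0∞) ≤ 2 * R + K := by
      calc (D : ℝ≥0∞) ≤ D + m (outEdges T) := le_self_add
        _ = 2 * (m (outEdges T) + m J) + m (inEdges T) := by rw [← hD, e1, e2]; ring
        _ = 2 * R + m (inEdges T) := by rw [← hR, e1]
        _ ≤ _ := by gcongr
    exact_mod_cast this
  have : ∑ i : Fin n, (2 * ((r (nthPoint 0 T i π) : ℕ) : ℤ) - (d (nthPoint 0 T i π) : ℕ)) =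
      2 * (R : ℤ) - D := by
    rw [Finset.sum_sub_distrib, ← Finset.mul_sum]
    push_cast [R, D]
    rfl
  rw [this, abs_le]
  constructor <;> omega

end Configurations

/-! ### The difference of right- and left-stubs -/

section Stubs

variable {Ω : Type*} [MeasurableSpace Ω] {P : Measure Ω} {μ : Measure ℕ}
  {N ξ ψ : Ω → Measure ℝ}

/-- Degrees of `μ`-measure zero do not occur. -/
lemma IsDegreeProcess.ae_degree_notMem (hN : IsPoissonProcess P N) (hξ : IsDegreeProcess P N ξ μ)
    {B : Set ℕ} (hB : μ B = 0) :
    ∀ᵐ ω ∂P, ∀ x ∈ points (N ω), ∀ d ∈ B, ξ ω {x} ≠ d := by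
  have key : ∀ (k : ℤ) (i : ℕ) (d : ℕ), ∀ᵐ ω ∂P, d ∈ B →
      ((i + 1 : ℕ) : ℝ≥0∞) ≤ N ω (Set.Ico (k : ℝ) (k + 1)) →
      ξ ω {nthPoint k (k + 1) i (N ω)} ≠ d := by
    intro k i d
    by_cases hd : d ∈ B
    · have hc := hξ.cond_law 1 (fun _ => nthPoint k (k + 1) i)
        {ν | ((i + 1 : ℕ) : ℝ≥0∞) ≤ ν (Set.Ico (k : ℝ) (k + 1))} (fun _ => d)
        (fun _ => measurable_nthPoint _ _ _)
        (measurableSet_le measurable_const (Measure.measurable_coe measurableSet_Ico)) (by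
          filter_upwards [hN.integer_valued, hN.ae_simple] with ω h1 h2 hA
          refine ⟨Function.injective_of_subsingleton _, fun _ => ?_⟩
          obtain ⟨n, hn⟩ := h1 (Set.Ico (k : ℝ) (k + 1)) measurableSet_Ico
            (Metric.isBounded_Ico _ _)
          have hA' : ((i + 1 : ℕ) : ℝ≥0∞) ≤ N ω (Set.Ico (k : ℝ) (k + 1)) := hA
          rw [hn] at hA'
          exact (nthPoint_spec h1 h2 (by linarith) hn
            (Nat.lt_of_succ_le (by exact_mod_cast hA'))).1)
      have h0 : μ {d} = 0 := measure_mono_null (by simpa using hd) hB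
      simp only [Finset.univ_unique, Finset.prod_singleton, h0, mul_zero] at hc
      refine measure_mono_null (fun ω hω => ?_) hc
      by_contra hno
      apply hω
      intro _ h1 h2
      exact hno ⟨h1, fun _ => h2⟩
    · exact Filter.Eventually.of_forall fun ω h => absurd h hd
  have key' : ∀ᵐ ω ∂P, ∀ (k : ℤ) (i : ℕ) (d : ℕ), d ∈ B →
      ((i + 1 : ℕ) : ℝ≥0∞) ≤ N ω (Set.Ico (k : ℝ) (k + 1)) →
      ξ ω {nthPoint k (k + 1) i (N ω)} ≠ d := by
    simp only [ae_all_iff] at key ⊢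
    exact key
  filter_upwards [hN.integer_valued, hN.ae_simple, key'] with ω h1 h2 h3 x hx d hd
  obtain ⟨n, hn⟩ := h1 (Set.Ico (⌊x⌋ : ℝ) (⌊x⌋ + 1)) measurableSet_Ico (Metric.isBounded_Ico _ _)
  obtain ⟨i, hi, hix⟩ := exists_nthPoint_eq h1 h2 (lt_add_one (⌊x⌋ : ℝ)) hn hx
    ⟨Int.floor_le x, Int.lt_floor_add_one x⟩
  rw [← hix]
  refine h3 _ i d hd ?_
  rw [hn]
  exact_mod_cast hi

/-- Given the number `n` of points in `[0, T)`, the number of right-stubs minus the number of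
left-stubs there takes each value with probability at most `1 / √n`. -/
lemma IsDirectionProcess.prob_stubs_eq_le [IsProbabilityMeasure μ] (hμ : μ {0} = 0)
    (hN : IsPoissonProcess P N) (hξ : IsDegreeProcess P N ξ μ) (hψ : IsDirectionProcess P N ξ ψ)
    {T : ℝ} (hT : 0 < T) {n : ℕ} (hn : n ≠ 0) (j : ℤ) :
    P {ω | N ω (Set.Ico 0 T) = n ∧ ∃ d r : Fin n → ℕ,
      (∀ i : Fin n, ξ ω {nthPoint 0 T i (N ω)} = d i ∧ ψ ω {nthPoint 0 T i (N ω)} = r i) ∧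
      ∑ i : Fin n, (2 * (r i : ℤ) - d i) = j} ≤
    P {ω | N ω (Set.Ico 0 T) = n} * ENNReal.ofReal (1 / √n) := by
  classical
  set A : Set (Measure ℝ) := {ν | ν (Set.Ico 0 T) = n} with hA
  have hAm : MeasurableSet A :=
    measurableSet_eq_fun (Measure.measurable_coe measurableSet_Ico) measurable_const
  have hy : ∀ᵐ ω ∂P, N ω ∈ A → Function.Injective (fun i : Fin n => nthPoint 0 T i (N ω)) ∧
      ∀ i : Fin n, nthPoint 0 T i (N ω) ∈ points (N ω) := by
    filter_upwards [hN.integer_valued, hN.ae_simple] with ω h1 h2 hA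
    exact ⟨nthPoint_injective h1 h2 hT hA, fun i => (nthPoint_spec h1 h2 hT hA i.2).1⟩
  have hlaw : ∀ d r : Fin n → ℕ, P {ω | N ω ∈ A ∧
      ∀ i : Fin n, ξ ω {nthPoint 0 T i (N ω)} = d i ∧ ψ ω {nthPoint 0 T i (N ω)} = r i} =
      P {ω | N ω ∈ A} * (∏ i, μ {d i}) *
        ∏ i, binomial (d i) ⟨1 / 2, by norm_num, by norm_num⟩ {r i} := by
    intro d r
    have h1 := hξ.cond_law n (fun i => nthPoint 0 T i) A d (fun i => measurable_nthPoint _ _ _)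
      hAm hy
    have h2 := hψ.cond_law n (fun i c => nthPoint 0 T i c.1) (Prod.fst ⁻¹' A) d r
      (fun i => (measurable_nthPoint _ _ _).comp measurable_fst) (measurable_fst hAm) hy
    simp only [Set.mem_preimage] at h2
    rw [h2, h1]
  calc P {ω | N ω (Set.Ico 0 T) = n ∧ ∃ d r : Fin n → ℕ,
      (∀ i : Fin n, ξ ω {nthPoint 0 T i (N ω)} = d i ∧ ψ ω {nthPoint 0 T i (N ω)} = r i) ∧
      ∑ i : Fin n, (2 * (r i : ℤ) - d i) = j}
      ≤ P (⋃ d : Fin n → ℕ, ⋃ r : Fin n → ℕ, {ω | ∑ i : Fin n, (2 * (r i : ℤ) - d i) = j ∧ N ω ∈ A ∧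
        ∀ i : Fin n, ξ ω {nthPoint 0 T i (N ω)} = d i ∧ ψ ω {nthPoint 0 T i (N ω)} = r i}) := by
        refine measure_mono ?_
        rintro ω ⟨h1, d, r, h2, h3⟩
        simp only [Set.mem_iUnion]
        exact ⟨d, r, h3, h1, h2⟩
    _ ≤ ∑' d : Fin n → ℕ, ∑' r : Fin n → ℕ, P {ω | ∑ i : Fin n, (2 * (r i : ℤ) - d i) = j ∧
        N ω ∈ A ∧ ∀ i : Fin n,
          ξ ω {nthPoint 0 T i (N ω)} = d i ∧ ψ ω {nthPoint 0 T i (N ω)} = r i} :=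
        (measure_iUnion_le _).trans (ENNReal.tsum_le_tsum fun d => measure_iUnion_le _)
    _ ≤ ∑' d : Fin n → ℕ, P {ω | N ω ∈ A} * (∏ i, μ {d i}) * ENNReal.ofReal (1 / √n) := by
        refine ENNReal.tsum_le_tsum fun d => ?_
        -- given `d`, the value `j` of the difference determines `∑ i, r i`
        by_cases hd : ∀ i, d i ≠ 0
        · refine le_trans ?_ (mul_le_mul_right (tsum_prod_binomial_le hn d hd
            ((j + ∑ i, (d i : ℤ)) / 2).toNat) _)
          rw [← ENNReal.tsum_mul_left]
          refine ENNReal.tsum_le_tsum fun r => ?_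
          by_cases hr : ∑ i : Fin n, (2 * (r i : ℤ) - d i) = j
          · rw [if_pos]
            · refine (measure_mono ?_).trans (hlaw d r).le
              exact fun ω hω => hω.2
            · rw [Finset.sum_sub_distrib, ← Finset.mul_sum] at hr
              have h2r : j + ∑ i, (d i : ℤ) = 2 * ((∑ i, r i : ℕ) : ℤ) := by
                push_cast
                linarith
              rw [h2r]
              omega
          · have : {ω | ∑ i : Fin n, (2 * (r i : ℤ) - d i) = j ∧ N ω ∈ A ∧ ∀ i : Fin n,
              ξ ω {nthPoint 0 T i (N ω)} = d i ∧ ψ ω {nthPoint 0 T i (N ω)} = r i} = ∅ :=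
              Set.eq_empty_of_forall_notMem fun ω hω => hr hω.1
            rw [this]
            simp
        · push Not at hd
          obtain ⟨i, hi⟩ := hd
          have h0 : ∏ i, μ {d i} = 0 := Finset.prod_eq_zero (Finset.mem_univ i) (by rw [hi, hμ])
          rw [h0, mul_zero, zero_mul, nonpos_iff_eq_zero, ENNReal.tsum_eq_zero]
          intro r
          refine measure_mono_null (fun ω hω => hω.2) ((hlaw d r).trans ?_)
          rw [h0, mul_zero, zero_mul]
    _ = P {ω | N ω ∈ A} * ENNReal.ofReal (1 / √n) * ∑' d : Fin n → ℕ, ∏ i, μ {d i} := by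
        rw [← ENNReal.tsum_mul_left]
        exact tsum_congr fun d => mul_right_comm _ _ _
    _ ≤ P {ω | N ω ∈ A} * ENNReal.ofReal (1 / √n) * 1 := by
        gcongr
        have : ∀ d : Fin n → ℕ, ∏ i, μ {d i} = Measure.pi (fun _ : Fin n => μ) {d} := fun d => by
          rw [Measure.pi_singleton]
        simp_rw [this]
        refine (tsum_meas_le_meas_iUnion_of_disjoint _
          (fun d => measurableSet_singleton d) fun a b hab => ?_).trans prob_le_one
        exact Set.disjoint_singleton.2 hab
    _ = _ := by rw [mul_one]; rfl

/-- With high probability, the numbers of right- and left-stubs in a long interval are not close to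
each other. -/
lemma IsDirectionProcess.prob_isBalanced_le [IsProbabilityMeasure P] [IsProbabilityMeasure μ]
    (hμ : μ {0} = 0) (hN : IsPoissonProcess P N) (hξ : IsDegreeProcess P N ξ μ)
    (hψ : IsDirectionProcess P N ξ ψ) {k : ℕ} (hk : k ≠ 0) (K : ℕ) :
    P {ω | IsBalanced ((4 * k : ℕ) : ℝ) K (N ω) (ξ ω) (ψ ω)} ≤
      ENNReal.ofReal ((1 / 2) ^ k + (2 * K + 1) * (1 / √k)) := by
  set T : ℝ := ((4 * k : ℕ) : ℝ) with hT
  have hTpos : 0 < T := by positivity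
  set F : ℕ → ℤ → Set Ω := fun n j => {ω | N ω (Set.Ico 0 T) = n ∧ ∃ d r : Fin n → ℕ,
      (∀ i : Fin n, ξ ω {nthPoint 0 T i (N ω)} = d i ∧ ψ ω {nthPoint 0 T i (N ω)} = r i) ∧
      ∑ i : Fin n, (2 * (r i : ℤ) - d i) = j} with hF
  have hsub : {ω | IsBalanced T K (N ω) (ξ ω) (ψ ω)} ⊆ {ω | N ω (Set.Ico 0 T) < k} ∪
      ⋃ n : ℕ, ⋃ j ∈ Finset.Icc (-K : ℤ) K, F (k + n) j := by
    rintro ω ⟨n, hn, d, r, h1, h2⟩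
    by_cases hnk : n < k
    · left
      change N ω (Set.Ico 0 T) < k
      rw [hn]
      exact_mod_cast hnk
    · right
      obtain ⟨n, rfl⟩ := Nat.exists_eq_add_of_le (not_lt.1 hnk)
      simp only [Set.mem_iUnion]
      refine ⟨n, _, ?_, hn, d, r, h1, rfl⟩
      rw [Finset.mem_Icc, ← abs_le]
      exact h2
  have hmeas : ∀ n : ℕ, MeasurableSet {ω | N ω (Set.Ico 0 T) = n} := fun n =>
    measurableSet_eq_fun ((Measure.measurable_coe measurableSet_Ico).comp hN.measurable)
      measurable_const
  calc P {ω | IsBalanced T K (N ω) (ξ ω) (ψ ω)}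
      ≤ P {ω | N ω (Set.Ico 0 T) < k} +
        ∑' n : ℕ, ∑ j ∈ Finset.Icc (-K : ℤ) K, P (F (k + n) j) := by
        refine (measure_mono hsub).trans ((measure_union_le _ _).trans ?_)
        gcongr
        refine (measure_iUnion_le _).trans (ENNReal.tsum_le_tsum fun n => ?_)
        exact measure_biUnion_finset_le _ _
    _ ≤ ENNReal.ofReal ((1 / 2) ^ k) + ∑' n : ℕ, P {ω | N ω (Set.Ico 0 T) = (k + n : ℕ)} *
        ((2 * K + 1 : ℕ) * ENNReal.ofReal (1 / √k)) := by
        gcongr with n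
        · refine (hN.prob_Ico_lt_le _ _).trans (ENNReal.ofReal_le_ofReal ?_)
          have h1 : Real.exp (-(((4 * k : ℕ) : ℝ) / 2)) = (Real.exp (-1) ^ 2) ^ k := by
            rw [← Real.exp_nat_mul, ← Real.exp_nat_mul]
            push_cast
            ring_nf
          have h2 : Real.exp (-1) ≤ 1 / 2 := by
            rw [Real.exp_neg, one_div]
            have := Real.add_one_le_exp (1 : ℝ)
            gcongr
            linarith
          rw [h1, ← mul_pow]
          gcongr
          have := Real.exp_pos (-1)
          nlinarith
        · calc ∑ j ∈ Finset.Icc (-K : ℤ) K, P (F (k + n) j)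
              ≤ ∑ j ∈ Finset.Icc (-K : ℤ) K, P {ω | N ω (Set.Ico 0 T) = (k + n : ℕ)} *
                ENNReal.ofReal (1 / √k) := by
                refine Finset.sum_le_sum fun j _ => ?_
                refine (hψ.prob_stubs_eq_le hμ hN hξ hTpos (by omega) j).trans ?_
                gcongr
                omega
            _ = _ := by
                rw [Finset.sum_const, nsmul_eq_mul, Int.card_Icc,
                  show ((K : ℤ) + 1 - -K).toNat = 2 * K + 1 by omega]
                ring
    _ ≤ ENNReal.ofReal ((1 / 2) ^ k) + 1 * ((2 * K + 1 : ℕ) * ENNReal.ofReal (1 / √k)) := by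
        rw [ENNReal.tsum_mul_right]
        gcongr
        refine (tsum_meas_le_meas_iUnion_of_disjoint P
          (fun n => hmeas (k + n)) ?_).trans prob_le_one
        intro a b hab
        refine Set.disjoint_left.2 fun ω h1 h2 => hab ?_
        have h1' : N ω (Set.Ico 0 T) = (k + a : ℕ) := h1
        have h2' : N ω (Set.Ico 0 T) = (k + b : ℕ) := h2
        rw [h1'] at h2'
        have : k + a = k + b := by exact_mod_cast h2'
        omega
    _ = _ := by
        rw [one_mul, ← ENNReal.ofReal_natCast, ← ENNReal.ofReal_mul (by positivity),
          ← ENNReal.ofReal_add (by positivity) (by positivity)]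
        push_cast
        rfl

end Stubs

/-! ### Edges over the origin in a configuration with degrees two -/

section TwoRegular

/-- A simple integer-valued measure counts its points. -/
lemma IsLocallyInteger.finite_and_measure_eq_ncard {ν : Measure (ℝ × ℝ)} (h : IsLocallyInteger ν)
    (hs : ∀ x, ν {x} ≤ 1) {B : Set (ℝ × ℝ)} (hB : ν B ≠ ∞) :
    (points ν ∩ B).Finite ∧ ν B = ((points ν ∩ B).ncard : ℝ≥0∞) := by
  have hB' : ν B = ν (points ν ∩ B) := by
    refine measure_congr ?_
    filter_upwards [h.ae_mem_points] with p hp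
    exact propext ⟨fun hpB => ⟨hp, hpB⟩, fun hpB => hpB.2⟩
  have hcard : ∀ t : Finset (ℝ × ℝ), (t : Set (ℝ × ℝ)) ⊆ points ν ∩ B → ν t = t.card := by
    intro t ht
    rw [← sum_measure_singleton, Finset.card_eq_sum_ones, Nat.cast_sum]
    refine Finset.sum_congr rfl fun x hx => ?_
    rw [Nat.cast_one]
    exact le_antisymm (hs x) (h.one_le (ht hx).1)
  have hfin : (points ν ∩ B).Finite := by
    by_contra hinf
    obtain ⟨n, hn⟩ := ENNReal.exists_nat_gt hB
    obtain ⟨t, ht, htc⟩ := (show (points ν ∩ B).Infinite from hinf).exists_subset_card_eq n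
    have := hcard t ht
    rw [htc] at this
    rw [hB', ← not_le] at hn
    exact hn (this ▸ measure_mono ht)
  refine ⟨hfin, ?_⟩
  have := hcard hfin.toFinset (by simp)
  rw [hfin.coe_toFinset] at this
  rw [hB', this, Set.ncard_eq_toFinset_card _ hfin]

variable {π ξ ψ : Measure ℝ} {m : Measure (ℝ × ℝ)}

lemma IsStableConfig.measure_fst_Ico_ne_top (h : IsStableConfig π ξ ψ m) {a b : ℝ} (hab : a < b) :
    m {p | p.1 ∈ Set.Ico a b} ≠ ∞ := by
  obtain ⟨n, hn⟩ := h.points_int (Set.Ico a b) measurableSet_Ico (Metric.isBounded_Ico _ _)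
  rw [h.measure_Ico_eq_sum hab hn measurable_fst (fun p hp => (h.endpoints p hp).1)]
  refine ENNReal.sum_ne_top.2 fun i _ => ?_
  have hpt := (nthPoint_spec h.points_int h.points_simple hab hn i.2).1
  have := h.degree_eq_add hpt
  exact ne_top_of_le_ne_top (h.degrees_int.ne_top Bornology.isBounded_singleton)
    (this ▸ le_self_add)

lemma IsStableConfig.measure_snd_Ico_ne_top (h : IsStableConfig π ξ ψ m) {a b : ℝ} (hab : a < b) :
    m {p | p.2 ∈ Set.Ico a b} ≠ ∞ := by
  obtain ⟨n, hn⟩ := h.points_int (Set.Ico a b) measurableSet_Ico (Metric.isBounded_Ico _ _)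
  rw [h.measure_Ico_eq_sum hab hn measurable_snd (fun p hp => (h.endpoints p hp).2)]
  refine ENNReal.sum_ne_top.2 fun i _ => ?_
  have hpt := (nthPoint_spec h.points_int h.points_simple hab hn i.2).1
  have := h.degree_eq_add hpt
  exact ne_top_of_le_ne_top (h.degrees_int.ne_top Bornology.isBounded_singleton)
    (this ▸ le_add_self)

lemma IsStableConfig.graph_adj_iff (h : IsStableConfig π ξ ψ m) {x y : points π} :
    (graph π m).Adj x y ↔ ((x : ℝ), (y : ℝ)) ∈ points m ∨ ((y : ℝ), (x : ℝ)) ∈ points m := by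
  rw [graph, SimpleGraph.fromRel_adj]
  refine ⟨fun hh => hh.2, fun hh => ⟨?_, hh⟩⟩
  rintro rfl
  exact hh.elim (fun hh => lt_irrefl _ (h.ordered _ hh)) (fun hh => lt_irrefl _ (h.ordered _ hh))

lemma IsStableConfig.graph_adj_iff_of_lt (h : IsStableConfig π ξ ψ m) {x y : points π}
    (hxy : x < y) : (graph π m).Adj x y ↔ ((x : ℝ), (y : ℝ)) ∈ points m := by
  rw [h.graph_adj_iff, or_iff_left]
  exact fun hh => lt_asymm hxy (h.ordered _ hh)

lemma IsStableConfig.exists_neighbors (h : IsStableConfig π ξ ψ m)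
    (h2 : ∀ x ∈ points π, ξ {x} = 2) (x : points π) :
    ∃ u w : points π, u ≠ w ∧ ∀ z, (graph π m).Adj x z ↔ z = u ∨ z = w := by
  have hm : m {p | p.1 = x ∨ p.2 = x} = 2 := by rw [h.degree x x.2, h2 x x.2]
  obtain ⟨hfin, hcard⟩ := h.edges_int.finite_and_measure_eq_ncard h.simple (by rw [hm]; simp)
  rw [hm] at hcard
  obtain ⟨p, q, hpq, hD⟩ := Set.ncard_eq_two.1 (show _ = 2 by exact_mod_cast hcard.symm)
  have hmem : ∀ r, r ∈ points m ∧ (r.1 = x ∨ r.2 = x) ↔ r = p ∨ r = q := fun r => by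
    have : r ∈ points m ∩ {p | p.1 = x ∨ p.2 = x} ↔ r ∈ ({p, q} : Set (ℝ × ℝ)) := by rw [hD]
    exact this
  have hend : ∀ r, r ∈ points m ∧ (r.1 = x ∨ r.2 = x) →
      ∃ u : points π, r = ((x : ℝ), (u : ℝ)) ∨ r = ((u : ℝ), (x : ℝ)) := by
    rintro ⟨r1, r2⟩ ⟨hr, rfl | rfl⟩
    · exact ⟨⟨r2, (h.endpoints _ hr).2⟩, Or.inl rfl⟩
    · exact ⟨⟨r1, (h.endpoints _ hr).1⟩, Or.inr rfl⟩
  obtain ⟨u, hu⟩ := hend p ((hmem p).2 (Or.inl rfl))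
  obtain ⟨w, hw⟩ := hend q ((hmem q).2 (Or.inr rfl))
  have hord := h.ordered
  have hpm := hord p ((hmem p).2 (Or.inl rfl)).1
  have hqm := hord q ((hmem q).2 (Or.inr rfl)).1
  refine ⟨u, w, ?_, fun z => ?_⟩
  · rintro rfl
    rcases hu with rfl | rfl <;> rcases hw with rfl | rfl
    · exact hpq rfl
    · exact lt_asymm hpm hqm
    · exact lt_asymm hpm hqm
    · exact hpq rfl
  · rw [h.graph_adj_iff]
    constructor
    · rintro (hz | hz)
      · rcases (hmem _).1 ⟨hz, Or.inl rfl⟩ with hh | hh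
        · left
          rcases hu with hu | hu <;> rw [hu, Prod.mk.injEq] at hh
          · exact Subtype.ext hh.2
          · exact Subtype.ext (hh.2.trans hh.1)
        · right
          rcases hw with hu | hu <;> rw [hu, Prod.mk.injEq] at hh
          · exact Subtype.ext hh.2
          · exact Subtype.ext (hh.2.trans hh.1)
      · rcases (hmem _).1 ⟨hz, Or.inr rfl⟩ with hh | hh
        · left
          rcases hu with hu | hu <;> rw [hu, Prod.mk.injEq] at hh
          · exact Subtype.ext (hh.1.trans hh.2)
          · exact Subtype.ext hh.1
        · right
          rcases hw with hu | hu <;> rw [hu, Prod.mk.injEq] at hh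
          · exact Subtype.ext (hh.1.trans hh.2)
          · exact Subtype.ext hh.1
    · rintro (rfl | rfl)
      · have := ((hmem p).2 (Or.inl rfl)).1
        rcases hu with hu | hu <;> rw [hu] at this
        · exact Or.inl this
        · exact Or.inr this
      · have := ((hmem q).2 (Or.inr rfl)).1
        rcases hw with hu | hu <;> rw [hu] at this
        · exact Or.inl this
        · exact Or.inr this

/-- The edges crossing over `t`. -/
def crossingEdges (t : ℝ) : Set (ℝ × ℝ) := {p | p.1 < t ∧ t ≤ p.2}

lemma measurableSet_crossingEdges (t : ℝ) : MeasurableSet (crossingEdges t) :=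
  (measurable_fst measurableSet_Iio).inter (measurable_snd measurableSet_Ici)

/-- If all degrees are two and there is an infinite component, then only finitely many edges cross
over the origin. -/
lemma IsStableConfig.crossingEdges_ne_top (h : IsStableConfig π ξ ψ m)
    (h2 : ∀ x ∈ points π, ξ {x} = 2) (hinf : HasInfiniteComponent π m) :
    m (crossingEdges 0) ≠ ∞ := by
  obtain ⟨C, hC⟩ := hinf
  obtain ⟨x, y, hxy, hno⟩ := exists_not_enclosed (G := graph π m)
    (fun a b => ((h.points_int.finite_points (Metric.isBounded_Icc (a : ℝ) b)).preimage
      Subtype.val_injective.injOn).subset fun z hz => ⟨z.2, hz.1, hz.2⟩)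
    (h.exists_neighbors h2)
    (fun x y hxy => by
      have hxy' : (x : ℝ) < y := hxy
      rcases h.stable x x.2 y y.2 hxy with hh | hh | hh
      · exact Or.inl ((h.graph_adj_iff_of_lt hxy).2 hh)
      · refine Or.inr (Or.inl fun z hxz hz => ?_)
        have hxz' : (x : ℝ) < z := hxz
        have := hh z ((h.graph_adj_iff_of_lt hxz).1 hz)
        rw [abs_of_neg (by linarith), abs_of_neg (by linarith)] at this
        exact Subtype.coe_le_coe.1 (by linarith)
      · refine Or.inr (Or.inr fun z hxz hz => ?_)
        have hxz' : (z : ℝ) < y := hxz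
        have := hh z ((h.graph_adj_iff_of_lt hxz).1 hz)
        rw [abs_of_neg (by linarith), abs_of_neg (by linarith)] at this
        exact Subtype.coe_le_coe.1 (by linarith)) C hC
  have hsub : m (crossingEdges 0) ≤
      m ({p | p.1 ∈ Set.Ico (min (x : ℝ) 0 - 1) 0} ∪
        {p | p.2 ∈ Set.Ico 0 (max (y : ℝ) 0 + 1)}) := by
    refine measure_mono_ae ?_
    filter_upwards [h.edges_int.ae_mem_points] with p hp hp0
    obtain ⟨h1, h3⟩ : p.1 < 0 ∧ 0 ≤ p.2 := hp0
    -- as `p` does not enclose `x` and `y`, one of its ends is confined to a bounded interval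
    by_cases hc : p.1 < x
    · right
      refine ⟨h3, ?_⟩
      by_contra! hc2
      have hy : (y : ℝ) < p.2 := by linarith [le_max_left (y : ℝ) 0]
      obtain ⟨e1, e2⟩ := h.endpoints p hp
      exact hno ⟨p.1, e1⟩ ⟨p.2, e2⟩ hc hy ((h.graph_adj_iff).2 (Or.inl hp))
    · left
      exact ⟨by linarith [min_le_left (x : ℝ) 0], h1⟩
  refine ne_top_of_le_ne_top ?_ (hsub.trans (measure_union_le _ _))
  exact ENNReal.add_ne_top.2 ⟨h.measure_fst_Ico_ne_top (by linarith [min_le_right (x : ℝ) 0]),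
    h.measure_snd_Ico_ne_top (by linarith [le_max_right (y : ℝ) 0])⟩

end TwoRegular

/-! ### Infinitely many edges cross over the origin -/

section Crossing

variable {Ω : Type*} [MeasurableSpace Ω] {P : Measure Ω} {μ : Measure ℕ}
  {N ξ ψ : Ω → Measure ℝ} {M : Ω → Measure (ℝ × ℝ)}

lemma measurable_translate (t : ℝ) : Measurable fun p : ℝ × ℝ => (p.1 + t, p.2 + t) := by
  fun_prop

lemma IsMatchingScheme.prob_crossingEdges (hM : IsMatchingScheme P N ξ M) (t : ℝ) {S : Set ℝ≥0∞}
    (hS : MeasurableSet S) :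
    P {ω | M ω (crossingEdges t) ∈ S} = P {ω | M ω (crossingEdges 0) ∈ S} := by
  have hS' : MeasurableSet {m : Measure (ℝ × ℝ) | m (crossingEdges 0) ∈ S} :=
    Measure.measurable_coe (measurableSet_crossingEdges 0) hS
  have h := congrArg (fun Q => Q {m : Measure (ℝ × ℝ) | m (crossingEdges 0) ∈ S})
    (hM.translation_invariant (-t))
  beta_reduce at h
  have hMt : Measurable fun ω => (M ω).map (fun p => (p.1 + -t, p.2 + -t)) :=
    (Measure.measurable_map _ (measurable_translate _)).comp hM.measurable
  rw [Measure.map_apply hMt hS', Measure.map_apply hM.measurable hS'] at h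
  rw [Set.preimage_ofPred_eq, Set.preimage_ofPred_eq] at h
  rw [← h]
  congr 1
  ext ω
  have : M ω (crossingEdges t) =
      (M ω).map (fun p => (p.1 + -t, p.2 + -t)) (crossingEdges 0) := by
    rw [Measure.map_apply (measurable_translate _) (measurableSet_crossingEdges 0)]
    congr 1
    ext p
    change p.1 < t ∧ t ≤ p.2 ↔ p.1 + -t < 0 ∧ 0 ≤ p.2 + -t
    constructor <;> rintro ⟨h1, h2⟩ <;> constructor <;> linarith
  change _ ∈ S ↔ _ ∈ S
  rw [this]

/-- Almost surely, infinitely many edges cross over the origin. Otherwise, on an event of positive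
probability, the difference of the numbers of right- and left-stubs in `[0, T)` would be bounded by
stationary random variables, although it is not tight as `T → ∞`. -/
lemma IsRandomDirectionStable.ae_crossingEdges_eq_top [IsProbabilityMeasure P]
    [IsProbabilityMeasure μ] (hμ : μ {0} = 0) (hN : IsPoissonProcess P N)
    (hξ : IsDegreeProcess P N ξ μ) (hψ : IsDirectionProcess P N ξ ψ)
    (hM : IsRandomDirectionStable P N ξ ψ M) : ∀ᵐ ω ∂P, M ω (crossingEdges 0) = ∞ := by
  set F : ℕ → Set Ω := fun K => {ω | M ω (crossingEdges 0) ∈ Set.Ioo (K : ℝ≥0∞) ∞} with hF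
  have hmeas : Measurable fun ω => M ω (crossingEdges 0) :=
    (Measure.measurable_coe (measurableSet_crossingEdges 0)).comp hM.measurable
  have hle : ∀ K k : ℕ, k ≠ 0 → P {ω | ¬ M ω (crossingEdges 0) = ∞} ≤
      ENNReal.ofReal ((1 / 2) ^ k + (2 * K + 1) * (1 / √k)) + (P (F K) + P (F K)) := by
    intro K k hk
    set T : ℝ := ((4 * k : ℕ) : ℝ) with hT
    have hTpos : 0 < T := by positivity
    calc P {ω | ¬ M ω (crossingEdges 0) = ∞}
        ≤ P ({ω | IsBalanced T K (N ω) (ξ ω) (ψ ω)} ∪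
          ({ω | M ω (crossingEdges T) ∈ Set.Ioo (K : ℝ≥0∞) ∞} ∪ F K)) := by
          refine measure_mono_ae ?_
          filter_upwards [IsRandomDirectionStable.ae_isStableConfig hN hξ hψ hM] with ω h hω
          have hω0 : M ω (crossingEdges 0) ≠ ∞ := hω
          have hωT : M ω (crossingEdges T) ≠ ∞ := by
            refine ne_top_of_le_ne_top (ENNReal.add_ne_top.2
              ⟨hω0, h.measure_fst_Ico_ne_top hTpos⟩)
              ((measure_mono ?_).trans (measure_union_le _ _))
            rintro p ⟨h1, h2⟩
            rcases lt_or_ge p.1 0 with hp | hp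
            · exact Or.inl ⟨hp, hTpos.le.trans h2⟩
            · exact Or.inr ⟨hp, h1⟩
          by_cases c1 : (K : ℝ≥0∞) < M ω (crossingEdges T)
          · exact Or.inr (Or.inl ⟨c1, lt_top_iff_ne_top.2 hωT⟩)
          by_cases c2 : (K : ℝ≥0∞) < M ω (crossingEdges 0)
          · exact Or.inr (Or.inr ⟨c2, lt_top_iff_ne_top.2 hω0⟩)
          refine Or.inl (h.isBalanced hTpos ?_ ?_)
          · exact (measure_mono (show outEdges T ⊆ crossingEdges T from
              fun p hp => ⟨hp.1.2, hp.2⟩)).trans (not_lt.1 c1)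
          · exact (measure_mono (show inEdges T ⊆ crossingEdges 0 from
              fun p hp => ⟨hp.1, hp.2.1⟩)).trans (not_lt.1 c2)
      _ ≤ P {ω | IsBalanced T K (N ω) (ξ ω) (ψ ω)} +
          (P {ω | M ω (crossingEdges T) ∈ Set.Ioo (K : ℝ≥0∞) ∞} + P (F K)) :=
          (measure_union_le _ _).trans (add_le_add le_rfl (measure_union_le _ _))
      _ ≤ _ := by
          rw [hM.toIsMatchingScheme.prob_crossingEdges T measurableSet_Ioo]
          gcongr
          exact hψ.prob_isBalanced_le hμ hN hξ hk K
  have hle' : ∀ K : ℕ, P {ω | ¬ M ω (crossingEdges 0) = ∞} ≤ P (F K) + P (F K) := by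
    intro K
    have hlim : Tendsto (fun k : ℕ => ENNReal.ofReal ((1 / 2) ^ k + (2 * K + 1) * (1 / √k)) +
        (P (F K) + P (F K))) atTop (𝓝 (ENNReal.ofReal (0 + (2 * K + 1) * 0) +
        (P (F K) + P (F K)))) := by
      refine Tendsto.add (ENNReal.tendsto_ofReal (Tendsto.add ?_ (Tendsto.const_mul _ ?_)))
        tendsto_const_nhds
      · exact tendsto_pow_atTop_nhds_zero_of_lt_one (by norm_num) (by norm_num)
      · simp only [one_div]
        exact tendsto_inv_atTop_zero.comp
          (Real.tendsto_sqrt_atTop.comp tendsto_natCast_atTop_atTop)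
    have h0 := ge_of_tendsto hlim
      ((eventually_ne_atTop 0).mono fun k hk => hle K k hk)
    simpa using h0
  have hlimF : Tendsto (fun K => P (F K)) atTop (𝓝 0) := by
    have hanti : Antitone F := fun a b hab ω hω =>
      ⟨lt_of_le_of_lt (by exact_mod_cast hab) hω.1, hω.2⟩
    have := tendsto_measure_iInter_atTop (μ := P) (s := F)
      (fun K => (hmeas measurableSet_Ioo).nullMeasurableSet) hanti ⟨0, measure_ne_top _ _⟩
    have hempty : ⋂ K, F K = ∅ := by
      refine Set.eq_empty_of_forall_notMem fun ω hω => ?_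
      rw [Set.mem_iInter] at hω
      obtain ⟨n, hn⟩ := ENNReal.exists_nat_gt (hω 0).2.ne
      exact lt_asymm hn (hω n).1
    rwa [hempty, measure_empty] at this
  rw [ae_iff]
  have := ge_of_tendsto' (hlimF.add hlimF) hle'
  simpa using this

/-- In the case of constant degree two there is almost surely no infinite component. -/
lemma IsRandomDirectionStable.ae_not_hasInfiniteComponent [IsProbabilityMeasure P]
    [IsProbabilityMeasure μ] (hμ : μ {0} = 0) (hN : IsPoissonProcess P N)
    (hξ : IsDegreeProcess P N ξ μ) (hψ : IsDirectionProcess P N ξ ψ)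
    (hM : IsRandomDirectionStable P N ξ ψ M) (h2 : μ {2} = 1) :
    ∀ᵐ ω ∂P, ¬ HasInfiniteComponent (N ω) (M ω) := by
  have hc : μ {2}ᶜ = 0 := by
    rw [prob_compl_eq_zero_iff (measurableSet_singleton 2), h2]
  filter_upwards [IsRandomDirectionStable.ae_isStableConfig hN hξ hψ hM, hξ.ae_degree_notMem hN hc,
    IsRandomDirectionStable.ae_crossingEdges_eq_top hμ hN hξ hψ hM] with ω h hd htop hinf
  refine h.crossingEdges_ne_top (fun x hx => ?_) hinf htop
  obtain ⟨k, hk⟩ := h.degrees_int {x} (measurableSet_singleton x) Bornology.isBounded_singleton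
  by_cases hk2 : k = 2
  · rw [hk, hk2, Nat.cast_ofNat]
  · exact absurd hk (hd x hx k hk2)

end Crossing

/-! ### The intensity of long edges -/

section Intensity

/-- If the terms are `o(1 / √i)`, the partial sums are `o(√T)`. -/
lemma sum_range_le_of_tendsto {g : ℕ → ℝ} (hg0 : ∀ i, 0 ≤ g i)
    (hg : Tendsto (fun i => g i * √(i + 1)) atTop (𝓝 0)) {ε : ℝ} (hε : 0 < ε) :
    ∃ C, ∀ T : ℕ, ∑ i ∈ Finset.range T, g i ≤ C + 2 * ε * √T := by
  obtain ⟨a, ha⟩ := eventually_atTop.1 (hg.eventually_lt_const hε)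
  refine ⟨∑ i ∈ Finset.range a, g i, fun T => ?_⟩
  induction T with
  | zero => simpa using Finset.sum_nonneg fun i _ => hg0 i
  | succ T ih =>
    rcases lt_or_ge T a with h | h
    · have h1 : ∑ i ∈ Finset.range (T + 1), g i ≤ ∑ i ∈ Finset.range a, g i :=
        Finset.sum_le_sum_of_subset_of_nonneg (Finset.range_subset_range.2 h)
          fun i _ _ => hg0 i
      have : 0 ≤ 2 * ε * √((T + 1 : ℕ) : ℝ) := by positivity
      linarith
    · rw [Finset.sum_range_succ]
      have h1 := ha T h
      have hs : 0 < √((T : ℝ) + 1) := by positivity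
      have h2 : g T ≤ ε / √((T : ℝ) + 1) := by
        rw [le_div_iff₀ hs]
        exact h1.le
      have h3 : 1 / √((T : ℝ) + 1) ≤ 2 * (√((T : ℝ) + 1) - √T) := by
        rw [div_le_iff₀ hs]
        nlinarith [sq_nonneg (√((T : ℝ) + 1) - √T),
          Real.sq_sqrt (show (0 : ℝ) ≤ T + 1 by positivity),
          Real.sq_sqrt (show (0 : ℝ) ≤ T by positivity)]
      have h4 : ε / √((T : ℝ) + 1) ≤ ε * (2 * (√((T : ℝ) + 1) - √T)) := by
        rw [div_eq_mul_one_div]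
        gcongr
      push_cast
      linarith

/-- The length of an edge. -/
noncomputable def edgeLength (p : ℝ × ℝ) : ℝ≥0∞ := ENNReal.ofReal |p.1 - p.2|

lemma measurable_edgeLength : Measurable edgeLength :=
  ENNReal.measurable_ofReal.comp (continuous_abs.measurable.comp
    (measurable_fst.sub measurable_snd))

/-- The edges of length at least `i` whose end-point `e p` lies in `[a, a + 1)`. -/
def longEdges (e : ℝ × ℝ → ℝ) (a : ℝ) (i : ℕ) : Set (ℝ × ℝ) :=
  {p | e p ∈ Set.Ico a (a + 1) ∧ (i : ℝ≥0∞) ≤ edgeLength p}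

lemma measurableSet_longEdges {e : ℝ × ℝ → ℝ} (he : Measurable e) (a : ℝ) (i : ℕ) :
    MeasurableSet (longEdges e a i) :=
  (he measurableSet_Ico).inter (measurable_edgeLength measurableSet_Ici)

/-- If the square root of the edge length is integrable, the number of edges of length at least `i`
per unit length is `o(1 / √i)`. -/
lemma tendsto_longEdges {ρ : Measure (ℝ × ℝ)} {e : ℝ × ℝ → ℝ}
    (h0 : ρ {p | e p ∈ Set.Ico 0 1} ≠ ∞)
    (hint : ∫⁻ p in {p | e p ∈ Set.Ico 0 1}, edgeLength p ^ (1 / 2 : ℝ) ∂ρ ≠ ∞) :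
    Tendsto (fun i : ℕ => (ρ (longEdges e 0 i)).toReal * √(i + 1)) atTop (𝓝 0) := by
  set ρ₀ := ρ.restrict {p | e p ∈ Set.Ico 0 1} with hρ₀
  have hfin : IsFiniteMeasure ρ₀ := ⟨by
    rw [hρ₀, Measure.restrict_apply_univ]
    exact lt_top_iff_ne_top.2 h0⟩
  have hlong : ∀ i, ρ (longEdges e 0 i) = ρ₀ {p | (i : ℝ≥0∞) ≤ edgeLength p} := by
    intro i
    have hm : MeasurableSet {p | (i : ℝ≥0∞) ≤ edgeLength p} :=
      measurable_edgeLength measurableSet_Ici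
    rw [hρ₀, Measure.restrict_apply hm]
    congr 1
    ext p
    rw [longEdges, zero_add]
    exact and_comm
  have htail : Tendsto (ρ₀ ∘ fun i : ℕ => {p | (i : ℝ≥0∞) ≤ edgeLength p}) atTop (𝓝 0) := by
    have := tendsto_measure_iInter_atTop (μ := ρ₀)
      (s := fun i : ℕ => {p | (i : ℝ≥0∞) ≤ edgeLength p})
      (fun i => (measurable_edgeLength measurableSet_Ici).nullMeasurableSet)
      (fun a b hab p hp => le_trans (by exact_mod_cast hab : (a : ℝ≥0∞) ≤ b) hp)
      ⟨0, measure_ne_top _ _⟩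
    have hempty : ⋂ i : ℕ, {p | (i : ℝ≥0∞) ≤ edgeLength p} = ∅ := by
      refine Set.eq_empty_of_forall_notMem fun p hp => ?_
      rw [Set.mem_iInter] at hp
      obtain ⟨n, hn⟩ := ENNReal.exists_nat_gt (show edgeLength p ≠ ∞ from ENNReal.ofReal_ne_top)
      exact absurd (hp n) (not_le.2 hn)
    rwa [hempty, measure_empty] at this
  have hε := tendsto_setLIntegral_zero hint htail
  have hε' := ((ENNReal.tendsto_toReal ENNReal.zero_ne_top).comp hε).mul_const 2
  rw [ENNReal.toReal_zero, zero_mul] at hε'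
  refine squeeze_zero' (Eventually.of_forall fun i => by positivity) ?_ hε'
  filter_upwards [eventually_ge_atTop 1] with i hi
  have h1 : (i : ℝ≥0∞) ^ (1 / 2 : ℝ) * ρ₀ {p | (i : ℝ≥0∞) ≤ edgeLength p} ≤
      ∫⁻ p in {p | (i : ℝ≥0∞) ≤ edgeLength p}, edgeLength p ^ (1 / 2 : ℝ) ∂ρ₀ := by
    rw [← setLIntegral_const]
    exact setLIntegral_mono' (measurable_edgeLength measurableSet_Ici) fun p hp =>
      ENNReal.rpow_le_rpow hp (by norm_num)
  have hne : ∫⁻ p in {p | (i : ℝ≥0∞) ≤ edgeLength p}, edgeLength p ^ (1 / 2 : ℝ) ∂ρ₀ ≠ ∞ :=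
    ne_top_of_le_ne_top hint (setLIntegral_le_lintegral _ _)
  have h2 := ENNReal.toReal_mono hne h1
  rw [ENNReal.toReal_mul, ← ENNReal.toReal_rpow, ENNReal.toReal_natCast, ← Real.sqrt_eq_rpow] at h2
  have hi' : (1 : ℝ) ≤ i := by exact_mod_cast hi
  have h3 : √((i : ℝ) + 1) ≤ √i * 2 := by
    rw [Real.sqrt_le_left (by positivity), mul_pow, Real.sq_sqrt (by positivity)]
    linarith
  rw [hlong]
  calc (ρ₀ {p | (i : ℝ≥0∞) ≤ edgeLength p}).toReal * √((i : ℝ) + 1)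
      ≤ (ρ₀ {p | (i : ℝ≥0∞) ≤ edgeLength p}).toReal * (√i * 2) := by gcongr
    _ = √i * (ρ₀ {p | (i : ℝ≥0∞) ≤ edgeLength p}).toReal * 2 := by ring
    _ ≤ _ := by
      simp only [Function.comp_apply]
      gcongr

variable {ρ : Measure (ℝ × ℝ)}

/-- Translation invariance of the intensity of long edges. -/
lemma measure_longEdges_eq (hρ : ∀ t : ℝ, ρ.map (fun p => (p.1 + t, p.2 + t)) = ρ)
    {e : ℝ × ℝ → ℝ} (he : Measurable e) (het : ∀ p t, e (p.1 + t, p.2 + t) = e p + t)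
    (a : ℝ) (i : ℕ) : ρ (longEdges e a i) = ρ (longEdges e 0 i) := by
  nth_rewrite 1 [← hρ a]
  rw [Measure.map_apply (measurable_translate a) (measurableSet_longEdges he a i)]
  congr 1
  ext p
  change (e (p.1 + a, p.2 + a) ∈ Set.Ico a (a + 1) ∧ (i : ℝ≥0∞) ≤ edgeLength (p.1 + a, p.2 + a)) ↔
    e p ∈ Set.Ico 0 (0 + 1) ∧ (i : ℝ≥0∞) ≤ edgeLength p
  have h1 : edgeLength (p.1 + a, p.2 + a) = edgeLength p := by simp [edgeLength]
  rw [h1, het]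
  refine and_congr_left fun _ => ?_
  simp only [Set.mem_Ico]
  constructor <;> rintro ⟨h1, h2⟩ <;> constructor <;> linarith

lemma measure_outEdges_le (hρ : ∀ t : ℝ, ρ.map (fun p => (p.1 + t, p.2 + t)) = ρ) (T : ℕ) :
    ρ (outEdges T) ≤ ∑ i ∈ Finset.range T, ρ (longEdges Prod.fst 0 i) := by
  rw [← Finset.sum_range_reflect]
  calc ρ (outEdges T) ≤ ρ (⋃ j ∈ Finset.range T, longEdges Prod.fst j (T - 1 - j)) := by
        refine measure_mono ?_
        rintro p ⟨⟨h1, h2⟩, h3⟩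
        have h4 : ⌊p.1⌋₊ < T := (Nat.floor_lt h1).2 h2
        have h5 := Nat.lt_floor_add_one p.1
        rw [Set.mem_iUnion₂]
        refine ⟨⌊p.1⌋₊, Finset.mem_range.2 h4, ⟨Nat.floor_le h1, h5⟩, ?_⟩
        rw [edgeLength, ← ENNReal.ofReal_natCast]
        refine ENNReal.ofReal_le_ofReal ?_
        rw [Nat.cast_sub (by omega), Nat.cast_sub (by omega), abs_sub_comm]
        refine le_trans ?_ (le_abs_self _)
        push_cast
        linarith
    _ ≤ ∑ j ∈ Finset.range T, ρ (longEdges Prod.fst j (T - 1 - j)) := measure_biUnion_finset_le _ _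
    _ = _ := Finset.sum_congr rfl fun j _ =>
        measure_longEdges_eq hρ measurable_fst (fun _ _ => rfl) _ _

lemma measure_inEdges_le (hρ : ∀ t : ℝ, ρ.map (fun p => (p.1 + t, p.2 + t)) = ρ) (T : ℕ) :
    ρ (inEdges T) ≤ ∑ i ∈ Finset.range T, ρ (longEdges Prod.snd 0 i) := by
  calc ρ (inEdges T) ≤ ρ (⋃ j ∈ Finset.range T, longEdges Prod.snd j j) := by
        refine measure_mono ?_
        rintro p ⟨h1, h2, h3⟩
        have h4 : ⌊p.2⌋₊ < T := (Nat.floor_lt h2).2 h3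
        rw [Set.mem_iUnion₂]
        refine ⟨⌊p.2⌋₊, Finset.mem_range.2 h4, ⟨Nat.floor_le h2, Nat.lt_floor_add_one p.2⟩, ?_⟩
        rw [edgeLength, ← ENNReal.ofReal_natCast]
        refine ENNReal.ofReal_le_ofReal ?_
        have h5 := Nat.floor_le h2
        rw [abs_sub_comm]
        refine le_trans ?_ (le_abs_self _)
        linarith
    _ ≤ ∑ j ∈ Finset.range T, ρ (longEdges Prod.snd j j) := measure_biUnion_finset_le _ _
    _ = _ := Finset.sum_congr rfl fun j _ =>
        measure_longEdges_eq hρ measurable_snd (fun _ _ => rfl) _ _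

/-- The sums which bound the intensities of `outEdges T` and `inEdges T` are `o(√T)`. -/
lemma sum_longEdges_le {e : ℝ × ℝ → ℝ}
    (h0 : ρ {p | e p ∈ Set.Ico 0 1} ≠ ∞)
    (hint : ∫⁻ p in {p | e p ∈ Set.Ico 0 1}, edgeLength p ^ (1 / 2 : ℝ) ∂ρ ≠ ∞)
    {ε : ℝ} (hε : 0 < ε) :
    ∃ C : ℝ, ∀ T : ℕ, ∑ i ∈ Finset.range T, ρ (longEdges e 0 i) ≤
      ENNReal.ofReal (C + 2 * ε * √T) := by
  obtain ⟨C, hC⟩ := sum_range_le_of_tendsto (fun i => ENNReal.toReal_nonneg)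
    (tendsto_longEdges h0 hint) hε
  have hne : ∀ i, ρ (longEdges e 0 i) ≠ ∞ := fun i => by
    refine ne_top_of_le_ne_top h0 (measure_mono fun p hp => ?_)
    simpa using hp.1
  refine ⟨C, fun T => ?_⟩
  refine le_trans (le_of_eq ?_) (ENNReal.ofReal_le_ofReal (hC T))
  rw [ENNReal.ofReal_sum_of_nonneg fun _ _ => ENNReal.toReal_nonneg]
  exact Finset.sum_congr rfl fun i _ => (ENNReal.ofReal_toReal (hne i)).symm

variable {Ω : Type*} [MeasurableSpace Ω] {P : Measure Ω} {μ : Measure ℕ}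
  {N ξ ψ : Ω → Measure ℝ} {M : Ω → Measure (ℝ × ℝ)}

/-- The intensity measure of the edges inherits the translation invariance of their law. -/
lemma IsMatchingScheme.map_bind_translate (hM : IsMatchingScheme P N ξ M) (t : ℝ) :
    (P.bind M).map (fun p => (p.1 + t, p.2 + t)) = P.bind M := by
  ext B hB
  have hMt : Measurable fun ω => (M ω).map (fun p => (p.1 + t, p.2 + t)) :=
    (Measure.measurable_map _ (measurable_translate t)).comp hM.measurable
  rw [Measure.map_apply (measurable_translate t) hB,
    Measure.bind_apply (measurable_translate t hB) hM.measurable.aemeasurable,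
    Measure.bind_apply hB hM.measurable.aemeasurable]
  have h := congrArg (fun Q => ∫⁻ m, m B ∂Q) (hM.translation_invariant t)
  beta_reduce at h
  rw [lintegral_map (Measure.measurable_coe hB) hMt,
    lintegral_map (Measure.measurable_coe hB) hM.measurable] at h
  rw [← h]
  refine lintegral_congr fun ω => ?_
  rw [Measure.map_apply (measurable_translate t) hB]

/-- The expected number of edges leaving an interval of length `T` is at least of order `√T`. -/
lemma IsRandomDirectionStable.le_bind_outEdges_add_inEdges [IsProbabilityMeasure P]
    [IsProbabilityMeasure μ] (hμ : μ {0} = 0) (hN : IsPoissonProcess P N)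
    (hξ : IsDegreeProcess P N ξ μ) (hψ : IsDirectionProcess P N ξ ψ)
    (hM : IsRandomDirectionStable P N ξ ψ M) {K : ℕ} (hK : K ≠ 0) :
    ENNReal.ofReal (K / 2) ≤ P.bind M (outEdges (256 * K ^ 2 : ℕ)) +
      P.bind M (inEdges (256 * K ^ 2 : ℕ)) := by
  -- For `T = 4k` with `k = 64 K ^ 2` one has `√k = 8 K`, so a difference of at most `K` between the
  have hk : 64 * K ^ 2 ≠ 0 := by positivity
  have hT : 256 * K ^ 2 = 4 * (64 * K ^ 2) := by ring
  have hTpos : (0 : ℝ) < (256 * K ^ 2 : ℕ) := by positivity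
  have hbal := hψ.prob_isBalanced_le hμ hN hξ hk K
  rw [← hT] at hbal
  set T : ℝ := ((256 * K ^ 2 : ℕ) : ℝ)
  have hKr : (1 : ℝ) ≤ K := by exact_mod_cast Nat.one_le_iff_ne_zero.2 hK
  have hsqrt : √((64 * K ^ 2 : ℕ) : ℝ) = 8 * K := by
    push_cast
    rw [show (64 * (K : ℝ) ^ 2) = (8 * K) ^ 2 by ring, Real.sqrt_sq (by positivity)]
  have hhalf : ((1 / 2 : ℝ) ^ (64 * K ^ 2) +
      (2 * K + 1) * (1 / √((64 * K ^ 2 : ℕ) : ℝ))) ≤ 1 / 2 := by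
    have h1 : (1 / 2 : ℝ) ^ (64 * K ^ 2) ≤ (1 / 2) ^ 3 := by
      refine pow_le_pow_of_le_one (by norm_num) (by norm_num) ?_
      have : 1 ≤ K ^ 2 := Nat.one_le_iff_ne_zero.2 (by positivity)
      omega
    have h2 : (2 * (K : ℝ) + 1) * (1 / √((64 * K ^ 2 : ℕ) : ℝ)) ≤ 3 / 8 := by
      rw [hsqrt, mul_one_div, div_le_iff₀ (by positivity)]
      linarith
    linarith
  have hbal2 : P {ω | IsBalanced T K (N ω) (ξ ω) (ψ ω)} ≤ ENNReal.ofReal (1 / 2) :=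
    hbal.trans (ENNReal.ofReal_le_ofReal hhalf)
  have hcover : (1 : ℝ≥0∞) ≤ ENNReal.ofReal (1 / 2) +
      (P {ω | (K : ℝ≥0∞) ≤ M ω (outEdges T)} + P {ω | (K : ℝ≥0∞) ≤ M ω (inEdges T)}) := by
    calc (1 : ℝ≥0∞) = P Set.univ := measure_univ.symm
      _ ≤ P ({ω | IsBalanced T K (N ω) (ξ ω) (ψ ω)} ∪
          ({ω | (K : ℝ≥0∞) ≤ M ω (outEdges T)} ∪ {ω | (K : ℝ≥0∞) ≤ M ω (inEdges T)})) := by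
          refine measure_mono_ae ?_
          filter_upwards [IsRandomDirectionStable.ae_isStableConfig hN hξ hψ hM] with ω h _
          by_cases c1 : (K : ℝ≥0∞) ≤ M ω (outEdges T)
          · exact Or.inr (Or.inl c1)
          by_cases c2 : (K : ℝ≥0∞) ≤ M ω (inEdges T)
          · exact Or.inr (Or.inr c2)
          exact Or.inl (h.isBalanced hTpos (not_le.1 c1).le (not_le.1 c2).le)
      _ ≤ _ := (measure_union_le _ _).trans (add_le_add hbal2 (measure_union_le _ _))
  have hsum : ENNReal.ofReal (1 / 2) ≤
      P {ω | (K : ℝ≥0∞) ≤ M ω (outEdges T)} + P {ω | (K : ℝ≥0∞) ≤ M ω (inEdges T)} := by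
    have h1 : (1 : ℝ≥0∞) = ENNReal.ofReal (1 / 2) + ENNReal.ofReal (1 / 2) := by
      rw [← ENNReal.ofReal_add (by norm_num) (by norm_num)]
      norm_num
    rw [h1] at hcover
    exact (ENNReal.add_le_add_iff_left ENNReal.ofReal_ne_top).1 hcover
  calc ENNReal.ofReal (K / 2) = K * ENNReal.ofReal (1 / 2) := by
        rw [← ENNReal.ofReal_natCast, ← ENNReal.ofReal_mul (by positivity), mul_one_div]
    _ ≤ K * (P {ω | (K : ℝ≥0∞) ≤ M ω (outEdges T)} + P {ω | (K : ℝ≥0∞) ≤ M ω (inEdges T)}) := by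
        gcongr
    _ ≤ ∫⁻ ω, M ω (outEdges T) ∂P + ∫⁻ ω, M ω (inEdges T) ∂P := by
        rw [mul_add]
        exact add_le_add
          (mul_meas_ge_le_lintegral ((Measure.measurable_coe (measurableSet_outEdges T)).comp
            hM.measurable) _)
          (mul_meas_ge_le_lintegral ((Measure.measurable_coe (measurableSet_inEdges T)).comp
            hM.measurable) _)
    _ = _ := by
        rw [Measure.bind_apply (measurableSet_outEdges T) hM.measurable.aemeasurable,
          Measure.bind_apply (measurableSet_inEdges T) hM.measurable.aemeasurable]

/-- The square root of the edge length is not integrable with respect to the intensity measure. -/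
lemma IsRandomDirectionStable.not_integrable_sqrt_edgeLength [IsProbabilityMeasure P]
    [IsProbabilityMeasure μ] (hμ : μ {0} = 0) (hN : IsPoissonProcess P N)
    (hξ : IsDegreeProcess P N ξ μ) (hψ : IsDirectionProcess P N ξ ψ)
    (hM : IsRandomDirectionStable P N ξ ψ M)
    (h1 : P.bind M {p | p.1 ∈ Set.Ico 0 1} ≠ ∞) (h2 : P.bind M {p | p.2 ∈ Set.Ico 0 1} ≠ ∞)
    (h1' : ∫⁻ p in {p | p.1 ∈ Set.Ico 0 1}, edgeLength p ^ (1 / 2 : ℝ) ∂(P.bind M) ≠ ∞)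
    (h2' : ∫⁻ p in {p | p.2 ∈ Set.Ico 0 1}, edgeLength p ^ (1 / 2 : ℝ) ∂(P.bind M) ≠ ∞) :
    False := by
  have hρ := hM.toIsMatchingScheme.map_bind_translate
  -- For `T = 256 K ^ 2`, the upper bounds add up to `K / 4 + C₁ + C₂`, against `K / 2` from below.
  obtain ⟨C₁, hC₁⟩ := sum_longEdges_le h1 h1' (ε := 1 / 256) (by norm_num)
  obtain ⟨C₂, hC₂⟩ := sum_longEdges_le h2 h2' (ε := 1 / 256) (by norm_num)
  obtain ⟨K, hK⟩ := exists_nat_gt (max 1 (4 * (|C₁| + |C₂|)))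
  have hK1 : (1 : ℝ) < K := (le_max_left _ _).trans_lt hK
  have hK2 := (le_max_right _ _).trans_lt hK
  have hK0 : K ≠ 0 := by
    rintro rfl
    norm_num at hK1
  have h := (hM.le_bind_outEdges_add_inEdges hμ hN hξ hψ hK0).trans
    (add_le_add ((measure_outEdges_le hρ _).trans (hC₁ _))
      ((measure_inEdges_le hρ _).trans (hC₂ _)))
  have hsqrt : √((256 * K ^ 2 : ℕ) : ℝ) = 16 * K := by
    push_cast
    rw [show (256 * (K : ℝ) ^ 2) = (16 * K) ^ 2 by ring, Real.sqrt_sq (by positivity)]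
  rw [hsqrt] at h
  have h3 : ENNReal.ofReal (K / 2) ≤ ENNReal.ofReal ((|C₁| + 2 * (1 / 256) * (16 * K)) +
      (|C₂| + 2 * (1 / 256) * (16 * K))) := by
    rw [ENNReal.ofReal_add (by positivity) (by positivity)]
    refine h.trans (add_le_add (ENNReal.ofReal_le_ofReal ?_) (ENNReal.ofReal_le_ofReal ?_))
    · linarith [le_abs_self C₁]
    · linarith [le_abs_self C₂]
  rw [ENNReal.ofReal_le_ofReal_iff (by positivity)] at h3
  linarith

end Intensity

/-! ### Edge lengths and average edge lengths -/

section EdgeSums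

variable {π ξ ψ : Measure ℝ} {m : Measure (ℝ × ℝ)}

/-- An edge incident to `s` is at most `k` times as long as the average edge at `s`, if the degree
of `s` is at most `k`. -/
lemma IsStableConfig.edgeLength_le (h : IsStableConfig π ξ ψ m) {k : ℕ} (hk : k ≠ 0) {s : ℝ}
    (hs : ξ {s} ≤ k) {p : ℝ × ℝ} (hp : p ∈ points m) (hps : p.1 = s ∨ p.2 = s) :
    edgeLength p ≤ k * avgLength ξ m s := by
  have hk' : (k : ℝ≥0∞) ≠ 0 := by exact_mod_cast hk
  have h1 : edgeLength p ≤ ∫⁻ q in {p : ℝ × ℝ | p.1 = s ∨ p.2 = s}, edgeLength q ∂m := by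
    calc edgeLength p ≤ edgeLength p * m {p} := le_mul_of_one_le_right' (h.edges_int.one_le hp)
      _ = ∫⁻ q in {p}, edgeLength q ∂m := (lintegral_singleton _ _).symm
      _ ≤ _ := lintegral_mono_set (Set.singleton_subset_iff.2 hps)
  calc edgeLength p
      ≤ ∫⁻ q in {p : ℝ × ℝ | p.1 = s ∨ p.2 = s}, edgeLength q ∂m := h1
    _ = k * ((∫⁻ q in {p : ℝ × ℝ | p.1 = s ∨ p.2 = s}, edgeLength q ∂m) / k) :=
        (ENNReal.mul_div_cancel hk' (ENNReal.natCast_ne_top k)).symm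
    _ ≤ _ := by
        gcongr
        exact ENNReal.div_le_div_left hs _

/-- Edges with an end `e p` in `[0, 1)` have total square-root length controlled by the average edge
lengths at the points of `[0, 1)`. -/
lemma IsStableConfig.lintegral_sqrt_edgeLength_le (h : IsStableConfig π ξ ψ m) {k : ℕ}
    (hk : k ≠ 0) (hdeg : ∀ x ∈ points π, ξ {x} ≤ k) {e : ℝ × ℝ → ℝ} (he : Measurable e)
    (hend : ∀ p : ℝ × ℝ, p.1 = e p ∨ p.2 = e p) :
    ∫⁻ p in {p | e p ∈ Set.Ico 0 1}, edgeLength p ^ (1 / 2 : ℝ) ∂m ≤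
      (k : ℝ≥0∞) ^ (1 / 2 : ℝ) * k *
        ∫⁻ s in Set.Ico 0 1, avgLength ξ m s ^ (1 / 2 : ℝ) ∂π := by
  obtain ⟨n, hn⟩ := h.points_int (Set.Ico 0 1) measurableSet_Ico (Metric.isBounded_Ico _ _)
  have hinj := nthPoint_injective h.points_int h.points_simple one_pos hn
  have hspec := fun i : Fin n => nthPoint_spec h.points_int h.points_simple one_pos hn i.2
  set y : Fin n → ℝ := fun i => nthPoint 0 1 i π with hy
  have hep : ∀ p ∈ points m, e p ∈ points π := fun p hp => by
    obtain ⟨h1, h2⟩ := h.endpoints p hp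
    rcases hend p with hh | hh <;> rwa [← hh]
  have hset : ({p | e p ∈ Set.Ico 0 1} : Set (ℝ × ℝ)) =ᵐ[m] ⋃ i : Fin n, {p | e p = y i} := by
    filter_upwards [h.edges_int.ae_mem_points] with p hp
    refine propext ?_
    change e p ∈ Set.Ico 0 1 ↔ p ∈ ⋃ i : Fin n, {p | e p = y i}
    rw [Set.mem_iUnion]
    constructor
    · intro hpI
      obtain ⟨i, hi, hi'⟩ :=
        exists_nthPoint_eq h.points_int h.points_simple one_pos hn (hep p hp) hpI
      exact ⟨⟨i, hi⟩, hi'.symm⟩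
    · rintro ⟨i, hi⟩
      have hi' : e p = y i := hi
      rw [hi']
      exact (hspec i).2.1
  have hmeas : ∀ i, MeasurableSet {p | e p = y i} := fun i =>
    measurableSet_eq_fun he measurable_const
  have hdisj : Pairwise (Function.onFun Disjoint fun i => {p | e p = y i}) := by
    intro i j hij
    refine Set.disjoint_left.2 fun p hp hq => hij (hinj ?_)
    have hp' : e p = y i := hp
    have hq' : e p = y j := hq
    exact hp'.symm.trans hq'
  have hterm : ∀ i, ∫⁻ p in {p | e p = y i}, edgeLength p ^ (1 / 2 : ℝ) ∂m ≤
      (k : ℝ≥0∞) ^ (1 / 2 : ℝ) * k * avgLength ξ m (y i) ^ (1 / 2 : ℝ) := by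
    intro i
    have hdi := hdeg (y i) (hspec i).1
    calc ∫⁻ p in {p | e p = y i}, edgeLength p ^ (1 / 2 : ℝ) ∂m
        ≤ ∫⁻ _ in {p | e p = y i}, (k * avgLength ξ m (y i)) ^ (1 / 2 : ℝ) ∂m := by
          refine setLIntegral_mono_ae' (hmeas i) ?_
          filter_upwards [h.edges_int.ae_mem_points] with p hp hpi
          have hpi' : e p = y i := hpi
          exact ENNReal.rpow_le_rpow (h.edgeLength_le hk hdi hp (hpi' ▸ hend p)) (by norm_num)
      _ = (k * avgLength ξ m (y i)) ^ (1 / 2 : ℝ) * m {p | e p = y i} := setLIntegral_const _ _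
      _ ≤ (k * avgLength ξ m (y i)) ^ (1 / 2 : ℝ) * k := by
          gcongr
          refine le_trans (measure_mono fun p hp => ?_) ((h.degree _ (hspec i).1).trans_le hdi)
          have hpi : e p = y i := hp
          exact (show p.1 = y i ∨ p.2 = y i from hpi ▸ hend p)
      _ = _ := by
          rw [ENNReal.mul_rpow_of_nonneg _ _ (by norm_num)]
          ring
  calc ∫⁻ p in {p | e p ∈ Set.Ico 0 1}, edgeLength p ^ (1 / 2 : ℝ) ∂m
      = ∑ i : Fin n, ∫⁻ p in {p | e p = y i}, edgeLength p ^ (1 / 2 : ℝ) ∂m := by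
        rw [setLIntegral_congr hset, lintegral_iUnion hmeas hdisj, tsum_fintype]
    _ ≤ ∑ i : Fin n, (k : ℝ≥0∞) ^ (1 / 2 : ℝ) * k * avgLength ξ m (y i) ^ (1 / 2 : ℝ) :=
        Finset.sum_le_sum fun i _ => hterm i
    _ ≤ (k : ℝ≥0∞) ^ (1 / 2 : ℝ) * k *
        ∑ s ∈ Finset.univ.image y, avgLength ξ m s ^ (1 / 2 : ℝ) * π {s} := by
        rw [← Finset.mul_sum, Finset.sum_image hinj.injOn]
        gcongr with i
        exact le_mul_of_one_le_right' (h.points_int.one_le (hspec i).1)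
    _ = (k : ℝ≥0∞) ^ (1 / 2 : ℝ) * k *
        ∫⁻ s in (Finset.univ.image y : Finset ℝ), avgLength ξ m s ^ (1 / 2 : ℝ) ∂π := by
        rw [lintegral_finset]
    _ ≤ _ := by
        gcongr
        intro s hs
        simp only [Finset.coe_image, Finset.coe_univ, Set.image_univ, Set.mem_range] at hs
        obtain ⟨i, rfl⟩ := hs
        exact (hspec i).2.1

lemma IsStableConfig.measure_edges_le (h : IsStableConfig π ξ ψ m) {k : ℕ}
    (hdeg : ∀ x ∈ points π, ξ {x} ≤ k) {e : ℝ × ℝ → ℝ} (he : Measurable e)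
    (hend : ∀ p : ℝ × ℝ, p.1 = e p ∨ p.2 = e p) :
    m {p | e p ∈ Set.Ico 0 1} ≤ k * π (Set.Ico 0 1) := by
  obtain ⟨n, hn⟩ := h.points_int (Set.Ico 0 1) measurableSet_Ico (Metric.isBounded_Ico _ _)
  have hspec := fun i : Fin n => nthPoint_spec h.points_int h.points_simple one_pos hn i.2
  have hep : ∀ p ∈ points m, e p ∈ points π := fun p hp => by
    obtain ⟨h1, h2⟩ := h.endpoints p hp
    rcases hend p with hh | hh <;> rwa [← hh]
  rw [h.measure_Ico_eq_sum one_pos hn he hep, hn]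
  calc ∑ i : Fin n, m {p | e p = nthPoint 0 1 i π} ≤ ∑ _i : Fin n, (k : ℝ≥0∞) := by
        refine Finset.sum_le_sum fun i _ => ?_
        refine le_trans (measure_mono fun p hp => ?_)
          ((h.degree _ (hspec i).1).trans_le (hdeg _ (hspec i).1))
        have hpi : e p = nthPoint 0 1 i π := hp
        exact hpi ▸ hend p
    _ = _ := by
        rw [Finset.sum_const, Finset.card_univ, Fintype.card_fin, nsmul_eq_mul, mul_comm]

end EdgeSums

/-! ### The Palm law -/

section Palm

/-- The measure of the sections of a measurable set depends measurably on the parameter, for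
measures which are finite on bounded sets. -/
lemma measurable_measure_section {A E : Type*} [MeasurableSpace A] [NormedAddCommGroup E]
    [MeasurableSpace E] [OpensMeasurableSpace E] {L : A → Measure E} (hL : Measurable L)
    (hfin : ∀ a (n : ℕ), L a (Metric.closedBall 0 n) ≠ ∞) {t : Set (A × E)} (ht : MeasurableSet t) :
    Measurable fun a => L a (Prod.mk a ⁻¹' t) := by
  have hball : ∀ n : ℕ, MeasurableSet (Metric.closedBall (0 : E) n) := fun n =>
    Metric.isClosed_closedBall.measurableSet
  set κ : ℕ → Kernel A E := fun n => Kernel.restrict ⟨L, hL⟩ (hball n)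
  have hκ : ∀ n a, κ n a = (L a).restrict (Metric.closedBall 0 n) := fun n a =>
    Kernel.restrict_apply _ _ _
  have h1 : ∀ a, L a (Prod.mk a ⁻¹' t) = ⨆ n, κ n a (Prod.mk a ⁻¹' t) := by
    intro a
    have hmono : Monotone fun n : ℕ => Prod.mk a ⁻¹' t ∩ Metric.closedBall (0 : E) n :=
      fun i j hij => Set.inter_subset_inter_right _
        (Metric.closedBall_subset_closedBall (by exact_mod_cast hij))
    have := hmono.measure_iUnion (μ := L a)
    rw [← Set.inter_iUnion, Metric.iUnion_closedBall_nat, Set.inter_univ] at this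
    rw [this]
    refine iSup_congr fun n => ?_
    rw [hκ, Measure.restrict_apply' (hball n)]
  simp_rw [h1]
  refine Measurable.iSup fun n => ?_
  refine Kernel.measurable_kernel_prodMk_left_of_finite ht fun a => ⟨?_⟩
  rw [hκ, Measure.restrict_apply_univ]
  exact lt_top_iff_ne_top.2 (hfin a n)

/-- Translates of a locally finite random measure depend jointly measurably on the realisation and
on the translation. -/
lemma measurable_map_translate {A E : Type*} [MeasurableSpace A] [NormedAddCommGroup E]
    [MeasurableSpace E] [OpensMeasurableSpace E] {L : A → Measure E} (hL : Measurable L)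
    (hfin : ∀ a (n : ℕ), L a (Metric.closedBall 0 n) ≠ ∞) {τ : ℝ → E → E}
    (hτ : Measurable fun q : ℝ × E => τ q.1 q.2) :
    Measurable fun q : A × ℝ => (L q.1).map (τ q.2) := by
  refine Measure.measurable_of_measurable_coe _ fun B hB => ?_
  have hτ' : ∀ s, Measurable (τ s) := fun s => hτ.comp measurable_prodMk_left
  have ht : MeasurableSet {q : (A × ℝ) × E | τ q.1.2 q.2 ∈ B} :=
    (hτ.comp ((measurable_snd.comp measurable_fst).prodMk measurable_snd)) hB
  have := measurable_measure_section (L := fun q : A × ℝ => L q.1) (hL.comp measurable_fst)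
    (fun q n => hfin q.1 n) ht
  convert this using 2 with q
  rw [Measure.map_apply (hτ' _) hB]
  rfl

lemma measurable_avgLength_zero :
    Measurable fun c : Config => avgLength c.2.1 c.2.2 0 ^ (1 / 2 : ℝ) := by
  refine Measurable.pow_const ?_ _
  unfold avgLength
  have hS : MeasurableSet {p : ℝ × ℝ | p.1 = 0 ∨ p.2 = 0} :=
    (measurable_fst (measurableSet_singleton 0)).union (measurable_snd (measurableSet_singleton 0))
  refine Measurable.div ?_ ((Measure.measurable_coe (measurableSet_singleton 0)).comp
    (measurable_fst.comp measurable_snd))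
  simp_rw [← lintegral_indicator hS]
  exact (Measure.measurable_lintegral (measurable_edgeLength.indicator hS)).comp
    (measurable_snd.comp measurable_snd)

lemma avgLength_shift (s : ℝ) (c : Config) :
    avgLength (shift s c).2.1 (shift s c).2.2 0 = avgLength c.2.1 c.2.2 s := by
  have hS : MeasurableSet {p : ℝ × ℝ | p.1 = 0 ∨ p.2 = 0} :=
    (measurable_fst (measurableSet_singleton 0)).union (measurable_snd (measurableSet_singleton 0))
  have hτ : Measurable fun p : ℝ × ℝ => (p.1 - s, p.2 - s) := by fun_prop
  have hτ1 : Measurable fun x : ℝ => x - s := by fun_prop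
  simp only [avgLength, shift]
  congr 1
  · refine (setLIntegral_map hS measurable_edgeLength hτ).trans ?_
    have : (fun p : ℝ × ℝ => (p.1 - s, p.2 - s)) ⁻¹' {p | p.1 = 0 ∨ p.2 = 0} =
        {p | p.1 = s ∨ p.2 = s} := by
      ext p
      simp [sub_eq_zero]
    rw [this]
    simp [edgeLength]
  · rw [Measure.map_apply hτ1 (measurableSet_singleton 0)]
    congr 1
    ext x
    simp [sub_eq_zero]

variable {Ω : Type*} [MeasurableSpace Ω] {P : Measure Ω} {N ξ : Ω → Measure ℝ}
  {M : Ω → Measure (ℝ × ℝ)}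

/-- The refined Campbell formula for the average edge length at the origin of the Palm version.
A modification of the processes on a null set makes them locally finite everywhere, so that the
kernel in the definition of the Palm law is almost everywhere measurable. -/
lemma lintegral_palmLaw_avgLength (hN : IsPointProcess P N) (hξ : IsPointProcess P ξ)
    (hM : IsPointProcess P M) :
    ∫⁻ c, avgLength c.2.1 c.2.2 0 ^ (1 / 2 : ℝ) ∂palmLaw P N ξ M =
      (∫⁻ ω, N ω (Set.Ico 0 1) ∂P)⁻¹ *
        ∫⁻ ω, ∫⁻ s in Set.Ico 0 1, avgLength (ξ ω) (M ω) s ^ (1 / 2 : ℝ) ∂(N ω) ∂P := by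
  classical
  obtain ⟨Ω₀, hΩ₀, hΩ₀m, hsub⟩ := Filter.Eventually.exists_measurable_mem
    (hN.integer_valued.and (hξ.integer_valued.and hM.integer_valued))
  set N' : Ω → Measure ℝ := Ω₀.indicator N
  set ξ' : Ω → Measure ℝ := Ω₀.indicator ξ
  set M' : Ω → Measure (ℝ × ℝ) := Ω₀.indicator M
  have hmod : ∀ {E : Type} [NormedAddCommGroup E] [MeasurableSpace E] [OpensMeasurableSpace E]
      {L : Ω → Measure E}, (∀ ω ∈ Ω₀, IsLocallyInteger (L ω)) →
      ∀ ω (n : ℕ), Ω₀.indicator L ω (Metric.closedBall 0 n) ≠ ∞ := by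
    intro E _ _ _ L hL ω n
    by_cases hω : ω ∈ Ω₀
    · rw [Set.indicator_of_mem hω]
      exact (hL ω hω).ne_top Metric.isBounded_closedBall
    · rw [Set.indicator_of_notMem hω]
      simp
  have hNfin := hmod (L := N) fun ω hω => (hsub ω hω).1
  have hξfin := hmod (L := ξ) fun ω hω => (hsub ω hω).2.1
  have hMfin := hmod (L := M) fun ω hω => (hsub ω hω).2.2
  have hN'm : Measurable N' := hN.measurable.indicator hΩ₀m
  have hξ'm : Measurable ξ' := hξ.measurable.indicator hΩ₀m
  have hM'm : Measurable M' := hM.measurable.indicator hΩ₀m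
  have hshift : Measurable fun q : Ω × ℝ => shift q.2 (N' q.1, ξ' q.1, M' q.1) := by
    unfold shift
    refine Measurable.prodMk ?_ (Measurable.prodMk ?_ ?_)
    · exact measurable_map_translate hN'm hNfin (τ := fun s x => x - s)
        (measurable_snd.sub measurable_fst)
    · exact measurable_map_translate hξ'm hξfin (τ := fun s x => x - s)
        (measurable_snd.sub measurable_fst)
    · exact measurable_map_translate hM'm hMfin (τ := fun s p => (p.1 - s, p.2 - s))
        (by fun_prop)
  have hshiftω : ∀ ω, Measurable fun s : ℝ => shift s (N' ω, ξ' ω, M' ω) := fun ω =>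
    hshift.comp measurable_prodMk_left
  set κ' : Ω → Measure Config := fun ω =>
    ((N' ω).restrict (Set.Ico 0 1)).map fun s => shift s (N' ω, ξ' ω, M' ω)
  set κ : Ω → Measure Config := fun ω =>
    ((N ω).restrict (Set.Ico 0 1)).map fun s => shift s (N ω, ξ ω, M ω)
  have heq : ∀ ω ∈ Ω₀, N' ω = N ω ∧ ξ' ω = ξ ω ∧ M' ω = M ω := fun ω hω =>
    ⟨Set.indicator_of_mem hω _, Set.indicator_of_mem hω _, Set.indicator_of_mem hω _⟩
  have hκκ' : κ =ᵐ[P] κ' := by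
    filter_upwards [hΩ₀] with ω hω
    obtain ⟨h1, h2, h3⟩ := heq ω hω
    simp only [κ, κ', h1, h2, h3]
  have hκ'm : Measurable κ' := by
    refine Measure.measurable_of_measurable_coe _ fun B hB => ?_
    have ht : MeasurableSet {q : Ω × ℝ | q.2 ∈ Set.Ico (0 : ℝ) 1 ∧
        shift q.2 (N' q.1, ξ' q.1, M' q.1) ∈ B} :=
      (measurable_snd measurableSet_Ico).inter (hshift hB)
    convert measurable_measure_section hN'm hNfin ht using 2 with ω
    rw [Measure.map_apply (hshiftω ω) hB, Measure.restrict_apply (hshiftω ω hB), Set.inter_comm]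
    rfl
  have hκm : AEMeasurable κ P := ⟨κ', hκ'm, hκκ'⟩
  have hpalm : palmLaw P N ξ M = (∫⁻ ω, N ω (Set.Ico 0 1) ∂P)⁻¹ • P.bind κ := rfl
  rw [hpalm, lintegral_smul_measure, smul_eq_mul,
    Measure.lintegral_bind hκm measurable_avgLength_zero.aemeasurable]
  congr 1
  refine lintegral_congr_ae ?_
  filter_upwards [hκκ', hΩ₀] with ω h1 hω
  obtain ⟨e1, e2, e3⟩ := heq ω hω
  rw [h1, lintegral_map measurable_avgLength_zero (hshiftω ω)]
  simp only [avgLength_shift, e1, e2, e3]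

end Palm

/-! ### The square root of the average edge length -/

section SquareRoot

variable {Ω : Type*} [MeasurableSpace Ω] {P : Measure Ω} {μ : Measure ℕ}
  {N ξ ψ : Ω → Measure ℝ} {M : Ω → Measure (ℝ × ℝ)}

/-- For bounded degrees, the average edge length at a typical point has infinite expected square
root. -/
lemma IsRandomDirectionStable.lintegral_palmLaw_eq_top [IsProbabilityMeasure P]
    [IsProbabilityMeasure μ] (hμ : μ {0} = 0) (hN : IsPoissonProcess P N)
    (hξ : IsDegreeProcess P N ξ μ) (hψ : IsDirectionProcess P N ξ ψ)
    (hM : IsRandomDirectionStable P N ξ ψ M) {k : ℕ} (hk : μ (Set.Ioi k) = 0) :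
    ∫⁻ c, avgLength c.2.1 c.2.2 0 ^ (1 / 2 : ℝ) ∂palmLaw P N ξ M = ∞ := by
  rw [lintegral_palmLaw_avgLength hN.toIsPointProcess hξ.toIsPointProcess
    hM.toIsMatchingScheme.toIsPointProcess]
  by_contra hne
  have hc : (∫⁻ ω, N ω (Set.Ico 0 1) ∂P)⁻¹ ≠ 0 := ENNReal.inv_ne_zero.2 hN.lintegral_Ico_ne_top
  have hW : ∫⁻ ω, ∫⁻ s in Set.Ico 0 1, avgLength (ξ ω) (M ω) s ^ (1 / 2 : ℝ) ∂(N ω) ∂P ≠ ∞ :=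
    fun htop => hne (by rw [htop, ENNReal.mul_top hc])
  have hdeg : ∀ᵐ ω ∂P, ∀ x ∈ points (N ω), ξ ω {x} ≤ (k + 1 : ℕ) := by
    filter_upwards [hξ.ae_degree_notMem hN hk, hξ.integer_valued] with ω h1 h2 x hx
    obtain ⟨d, hd⟩ := h2 {x} (measurableSet_singleton x) Bornology.isBounded_singleton
    by_cases hdk : k < d
    · exact absurd hd (h1 x hx d hdk)
    · rw [hd]
      exact_mod_cast (by omega : d ≤ k + 1)
  have hgood := IsRandomDirectionStable.ae_isStableConfig hN hξ hψ hM
  have hmass : ∀ e : ℝ × ℝ → ℝ, Measurable e → (∀ p : ℝ × ℝ, p.1 = e p ∨ p.2 = e p) →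
      P.bind M {p | e p ∈ Set.Ico 0 1} ≠ ∞ := by
    intro e he hend
    have hS : MeasurableSet {p | e p ∈ Set.Ico 0 1} := he measurableSet_Ico
    rw [Measure.bind_apply hS hM.measurable.aemeasurable]
    refine ne_top_of_le_ne_top (b := ∫⁻ ω, (k + 1 : ℕ) * N ω (Set.Ico 0 1) ∂P) ?_
      (lintegral_mono_ae ?_)
    · rw [lintegral_const_mul' _ _ (ENNReal.natCast_ne_top _)]
      exact ENNReal.mul_ne_top (ENNReal.natCast_ne_top _) hN.lintegral_Ico_ne_top
    · filter_upwards [hgood, hdeg] with ω h1 h2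
      exact h1.measure_edges_le h2 he hend
  have hsqrt : ∀ e : ℝ × ℝ → ℝ, Measurable e → (∀ p : ℝ × ℝ, p.1 = e p ∨ p.2 = e p) →
      ∫⁻ p in {p | e p ∈ Set.Ico 0 1}, edgeLength p ^ (1 / 2 : ℝ) ∂(P.bind M) ≠ ∞ := by
    intro e he hend
    have hS : MeasurableSet {p | e p ∈ Set.Ico 0 1} := he measurableSet_Ico
    have hC : ((k + 1 : ℕ) : ℝ≥0∞) ^ (1 / 2 : ℝ) * (k + 1 : ℕ) ≠ ∞ :=
      ENNReal.mul_ne_top (ENNReal.rpow_ne_top_of_nonneg (by norm_num) (ENNReal.natCast_ne_top _))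
        (ENNReal.natCast_ne_top _)
    rw [← lintegral_indicator hS, Measure.lintegral_bind hM.measurable.aemeasurable
      ((measurable_edgeLength.pow_const _).indicator hS).aemeasurable]
    refine ne_top_of_le_ne_top (b := ∫⁻ ω, (((k + 1 : ℕ) : ℝ≥0∞) ^ (1 / 2 : ℝ) * (k + 1 : ℕ)) *
      ∫⁻ s in Set.Ico 0 1, avgLength (ξ ω) (M ω) s ^ (1 / 2 : ℝ) ∂(N ω) ∂P) ?_
      (lintegral_mono_ae ?_)
    · rw [lintegral_const_mul' _ _ hC]
      exact ENNReal.mul_ne_top hC hW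
    · filter_upwards [hgood, hdeg] with ω h1 h2
      rw [lintegral_indicator hS]
      exact h1.lintegral_sqrt_edgeLength_le (Nat.succ_ne_zero k) h2 he hend
  exact hM.not_integrable_sqrt_edgeLength hμ hN hξ hψ
    (hmass _ measurable_fst fun _ => Or.inl rfl) (hmass _ measurable_snd fun _ => Or.inr rfl)
    (hsqrt _ measurable_fst fun _ => Or.inl rfl) (hsqrt _ measurable_snd fun _ => Or.inr rfl)

end SquareRoot

end StablePoisson

theorem theorem1p2 {Ω : Type*} [MeasurableSpace Ω] (P : Measure Ω) [IsProbabilityMeasure P]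
    (μ : Measure ℕ) [IsProbabilityMeasure μ] (hμ : μ {0} = 0)
    (N ξ ψ : Ω → Measure ℝ) (M : Ω → Measure (ℝ × ℝ))
    (hN : StablePoisson.IsPoissonProcess P N)
    (hξ : StablePoisson.IsDegreeProcess P N ξ μ)
    (hψ : StablePoisson.IsDirectionProcess P N ξ ψ)
    (hM : StablePoisson.IsRandomDirectionStable P N ξ ψ M) :
    (μ {2} = 1 → ∀ᵐ ω ∂P, ¬ StablePoisson.HasInfiniteComponent (N ω) (M ω)) ∧
    ((∃ k : ℕ, μ (Set.Ioi k) = 0) →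
      ∫⁻ c, (StablePoisson.avgLength c.2.1 c.2.2 0) ^ (1 / 2 : ℝ)
        ∂(StablePoisson.palmLaw P N ξ M) = ∞) := by
  refine ⟨fun h2 => hM.ae_not_hasInfiniteComponent hμ hN hξ hψ h2, ?_⟩
  rintro ⟨k, hk⟩
  exact hM.lintegral_palmLaw_eq_top hμ hN hξ hψ hk
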